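/- **Definitions.** A measurement scenario $\mathbf X=\langle X,\Sigma,O\rangle$ consists of a finite set $X$ of measurements, a finite non-empty set $O_x$ of outcomes for each $x\in X$, and a simplicial complex $\Sigma$ on $X$ (a non-empty, downward closed family of subsets of $X$ that contains all singletons), whose faces are called contexts. For $U\subseteq X$ put $\mathcal E(U)=\prod_{x\in U}O_x$. An empirical model $e:\mathbf X$ is a family of probability distributions $e_\sigma$ on $\mathcal E(\sigma)$, $\sigma\in\Sigma$, such that the marginal of $e_\sigma$ on $\mathcal E(\tau)$ is $e_\tau$ whenever $\tau\subseteq\sigma$ in $\Sigma$. It is non-contextual if there is a probability distribution on $\mathcal E(X)$ whose marginal on $\mathcal E(\sigma)$ is $e_\sigma$ for every $\sigma\in\Sigma$. For $e:\langle X,\Sigma,O\rangle$ and $e':\langle X',\Sigma',O'\rangle$, the model $e\otimes e'$ has measurements $X\sqcup X'$ with their given outcomes, contexts $\sigma\sqcup\sigma'$ for $\sigma\in\Sigma$, $\sigma'\in\Sigma'$, and $(e\otimes e')_{\sigma\sqcup\sigma'}(s,s')=e_\sigma(s)\,e'_{\sigma'}(s')$. A run on $\mathbf X$ is a finite sequence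 $\bar x=(x_i,o_i)_{i=1}^n$ with distinct $x_i\in X$, $\sigma_{\bar x}:=\{x_1,\dots,x_n\}\in\Sigma$ and $o_i\in O_{x_i}$; it defines $s_{\bar x}\in\mathcal E(\sigma_{\bar x})$ by $x_i\mapsto o_i$. Two runs are consistent if they give the same outcome to every common measurement. A measurement protocol on $\mathbf X$ is a non-empty, prefix-closed set $Q$ of runs such that: if $\bar x\cdot(x,o)\in Q$, then $\bar x\cdot(x,o')\in Q$ for all $o'\in O_x$; and if $\bar x\cdot(x,o)\in Q$ and $\bar x\cdot(x',o')\in Q$, then $x=x'$. The scenario $\mathsf{MP}(\mathbf X)$ has the measurement protocols on $\mathbf X$ as measurements; the outcomes of $Q$ are its maximal runs in the prefix order; and $\{Q_1,\dots,Q_n\}$ is a context if $\bigcup_i\sigma_{\bar x_i}\in\Sigma$ for all pairwise consistent choices of runs $\bar x_i\in Q_i$. For $e:\mathbf X$, the model $\mathsf{MP}(e):\mathsf{MP}(\mathbf X)$ gives the joint outcome $(\bar x_i)_i$ of $\{Q_1,\dots,Q_n\}$ the probability $e_{\bigcup_i\sigma_{\bar x_i}}\bigl(\bigcup_i s_{\bar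 x_i}\bigr)$ if the $\bar x_i$ are pairwise consistent, and $0$ otherwise. A deterministic simulation of $e:\langle X,\Sigma,O\rangle$ by $d:\langle Y,\Theta,P\rangle$ consists of a map $\pi:X\to Y$ with $\pi(\sigma)\in\Theta$ for all $\sigma\in\Sigma$ and maps $h_x:P_{\pi(x)}\to O_x$, $x\in X$, such that for every $\sigma\in\Sigma$ the distribution $e_\sigma$ is the pushforward of $d_{\pi(\sigma)}$ along $t\mapsto\bigl(h_x(t(\pi(x)))\bigr)_{x\in\sigma}$. We write $d\rightsquigarrow e$ ($d$ simulates $e$) if there are a non-contextual empirical model $c$, on some measurement scenario, and a deterministic simulation of $e$ by $\mathsf{MP}(d\otimes c)$. **Theorem (No-cloning).** For every empirical model $e$, one has $e\rightsquigarrow e\otimes e$ if and only if $e$ is non-contextual. -/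

import Mathlib

universe u v

/-- A measurement scenario: a finite set `X` of measurements, a finite non-empty set `O x` of
outcomes for each measurement `x`, and a simplicial complex `contexts` on `X` (as `X` is finite,
all of its subsets are finite). The empty set counts as a face. -/
structure Scenario where
  X : Type u
  finX : Finite X
  O : X → Type u
  finO : ∀ x, Finite (O x)
  nonemptyO : ∀ x, Nonempty (O x)
  contexts : Set (Set X)
  contexts_nonempty : contexts.Nonempty
  contexts_down : ∀ σ ∈ contexts, ∀ τ, τ ⊆ σ → τ ∈ contexts
  contexts_singleton : ∀ x, {x} ∈ contexts

namespace Scenario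

/-- Joint outcomes `∏ x ∈ U, O x` for a set `U` of measurements. -/
abbrev Assignment (S : Scenario.{u}) (U : Set S.X) : Type u := (x : U) → S.O x

/-- Restriction of joint outcomes along `τ ⊆ σ`. -/
def restrict (S : Scenario.{u}) {σ τ : Set S.X} (h : τ ⊆ σ) (s : S.Assignment σ) :
    S.Assignment τ :=
  fun x => s ⟨x.1, h x.2⟩

theorem empty_mem_contexts (S : Scenario.{u}) : ∅ ∈ S.contexts := by
  obtain ⟨σ, hσ⟩ := S.contexts_nonempty
  exact S.contexts_down σ hσ ∅ (Set.empty_subset σ)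

end Scenario

/-- An empirical model on `S`: a compatible (no-signalling) family of probability distributions
on the joint outcomes of the contexts (each context has only finitely many joint outcomes). -/
@[ext]
structure EmpiricalModel (S : Scenario.{u}) where
  prob : (σ : Set S.X) → σ ∈ S.contexts → PMF (S.Assignment σ)
  compatible : ∀ (σ τ : Set S.X) (hσ : σ ∈ S.contexts) (hτ : τ ∈ S.contexts) (h : τ ⊆ σ),
    (prob σ hσ).map (S.restrict h) = prob τ hτ

/-- A model is non-contextual if some distribution on global assignments of outcomes to all
measurements marginalizes to it on every context. -/
def EmpiricalModel.NonContextual {S : Scenario.{u}} (e : EmpiricalModel S) : Prop :=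
  ∃ d : PMF (S.Assignment Set.univ), ∀ (σ : Set S.X) (hσ : σ ∈ S.contexts),
    d.map (S.restrict (Set.subset_univ σ)) = e.prob σ hσ

/-! ### Tensor product -/

/-- The tensor product of scenarios: disjoint union of the measurements, contexts given by the
simplicial join, i.e. the disjoint unions of a context of `S` and a context of `T`. -/
abbrev Scenario.tensor (S T : Scenario.{u}) : Scenario.{u} where
  X := S.X ⊕ T.X
  finX := by
    have := S.finX
    have := T.finX
    infer_instance
  O := Sum.elim S.O T.O
  finO := by
    rintro (x | x)
    · exact S.finO x
    · exact T.finO x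
  nonemptyO := by
    rintro (x | x)
    · exact S.nonemptyO x
    · exact T.nonemptyO x
  contexts := {ρ | Sum.inl ⁻¹' ρ ∈ S.contexts ∧ Sum.inr ⁻¹' ρ ∈ T.contexts}
  contexts_nonempty := ⟨∅, S.empty_mem_contexts, T.empty_mem_contexts⟩
  contexts_down := fun σ hσ τ h =>
    ⟨S.contexts_down _ hσ.1 _ (Set.preimage_mono h), T.contexts_down _ hσ.2 _ (Set.preimage_mono h)⟩
  contexts_singleton := by
    rintro (x | x)
    · refine ⟨S.contexts_down _ (S.contexts_singleton x) _ ?_,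
        T.contexts_down _ T.empty_mem_contexts _ ?_⟩ <;> intro y hy <;> simp_all
    · refine ⟨S.contexts_down _ S.empty_mem_contexts _ ?_,
        T.contexts_down _ (T.contexts_singleton x) _ ?_⟩ <;> intro y hy <;> simp_all

/-- The joint outcome `(s, t)` on `ρ = σ ⊔ τ`. -/
def Scenario.pairAssignment {S T : Scenario.{u}} {ρ : Set (S.tensor T).X}
    (s : S.Assignment (Sum.inl ⁻¹' ρ)) (t : T.Assignment (Sum.inr ⁻¹' ρ)) :
    (S.tensor T).Assignment ρ
  | ⟨Sum.inl x, hx⟩ => s ⟨x, hx⟩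
  | ⟨Sum.inr y, hy⟩ => t ⟨y, hy⟩

/-- The tensor product of models: on each context, the product distribution. -/
noncomputable def EmpiricalModel.tensor {S T : Scenario.{u}} (e : EmpiricalModel S)
    (d : EmpiricalModel T) : EmpiricalModel (S.tensor T) where
  prob := fun ρ hρ => (e.prob (Sum.inl ⁻¹' ρ) hρ.1).bind fun s =>
    (d.prob (Sum.inr ⁻¹' ρ) hρ.2).map fun t => Scenario.pairAssignment s t
  compatible := by
    intro σ τ hσ hτ h
    rw [← e.compatible _ _ hσ.1 hτ.1 (Set.preimage_mono h),
      ← d.compatible _ _ hσ.2 hτ.2 (Set.preimage_mono h), PMF.map_bind, PMF.bind_map]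
    congr 1
    funext s
    simp only [PMF.map_comp, Function.comp]
    congr 1
    funext t
    funext x
    obtain ⟨x | x, hx⟩ := x <;> rfl

/-! ### Deterministic morphisms and simulations -/

/-- A deterministic morphism `T ⟶ S`: a simplicial map from the measurements of `S` to those of
`T`, with a translation of outcomes. -/
structure DetMorphism (T S : Scenario.{u}) where
  onMeas : S.X → T.X
  simplicial : ∀ σ ∈ S.contexts, onMeas '' σ ∈ T.contexts
  onOut : (x : S.X) → T.O (onMeas x) → S.O x

/-- The map on joint outcomes over the image of `σ` induced by a deterministic morphism. -/
def DetMorphism.mapAssignment {T S : Scenario.{u}} (m : DetMorphism T S) (σ : Set S.X)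
    (t : T.Assignment (m.onMeas '' σ)) : S.Assignment σ :=
  fun x => m.onOut x.1 (t ⟨m.onMeas x.1, Set.mem_image_of_mem _ x.2⟩)

/-- The pushforward of an empirical model along a deterministic morphism. -/
noncomputable def EmpiricalModel.push {T S : Scenario.{u}} (m : DetMorphism T S)
    (d : EmpiricalModel T) : EmpiricalModel S where
  prob := fun σ hσ => (d.prob (m.onMeas '' σ) (m.simplicial σ hσ)).map (m.mapAssignment σ)
  compatible := by
    intro σ τ hσ hτ h
    rw [← d.compatible _ _ (m.simplicial σ hσ) (m.simplicial τ hτ) (Set.image_mono h),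
      PMF.map_comp, PMF.map_comp]
    rfl

/-! ### Measurement protocols -/

namespace Scenario

/-- A run: a finite sequence of measurements with outcomes, where the measurements are distinct
and form a context. -/
def IsRun (S : Scenario.{u}) (l : List (Σ x : S.X, S.O x)) : Prop :=
  (l.map Sigma.fst).Nodup ∧ {x | ∃ o, (⟨x, o⟩ : Σ x : S.X, S.O x) ∈ l} ∈ S.contexts

/-- A measurement protocol: a non-empty, prefix-closed set of runs such that, after each run, the
next measurement (if there is one) is determined, and all of its outcomes are allowed for. -/
@[ext]
structure Protocol (S : Scenario.{u}) where
  runs : Set (List (Σ x : S.X, S.O x))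
  isRun : ∀ l ∈ runs, S.IsRun l
  nonempty : runs.Nonempty
  prefix_mem : ∀ l m, l ++ m ∈ runs → l ∈ runs
  all_outcomes : ∀ l x o, l ++ [⟨x, o⟩] ∈ runs → ∀ o', l ++ [⟨x, o'⟩] ∈ runs
  determinate : ∀ l x o x' o', l ++ [⟨x, o⟩] ∈ runs → l ++ [⟨x', o'⟩] ∈ runs → x = x'

/-- The outcomes of a protocol: its maximal runs with respect to the prefix order. -/
def Protocol.Outcome {S : Scenario.{u}} (Q : S.Protocol) : Type u :=
  {l : List (Σ x : S.X, S.O x) // l ∈ Q.runs ∧ ∀ m ∈ Q.runs, l <+: m → m = l}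

/-- The runs `r i` are pairwise consistent: they give the same outcome to each measurement that
they share. -/
def Consistent (S : Scenario.{u}) {ι : Type v} (r : ι → List (Σ x : S.X, S.O x)) : Prop :=
  ∀ i j x o o', ⟨x, o⟩ ∈ r i → ⟨x, o'⟩ ∈ r j → o = o'

/-- The set of all measurements that occur in the runs `r i`. -/
def support (S : Scenario.{u}) {ι : Type v} (r : ι → List (Σ x : S.X, S.O x)) : Set S.X :=
  {x | ∃ o, ∃ i, ⟨x, o⟩ ∈ r i}

/-- The union of the joint outcomes recorded by the runs `r i` (meaningful when the runs are
pairwise consistent). -/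
noncomputable def union (S : Scenario.{u}) {ι : Type v} (r : ι → List (Σ x : S.X, S.O x)) :
    S.Assignment (S.support r) :=
  fun x => x.2.choose

/-- A set of protocols is compatible if any choice of pairwise consistent runs, one in each of
the protocols, uses in total a set of measurements that is a context. -/
def CompatibleProtocols (S : Scenario.{u}) (σ : Set S.Protocol) : Prop :=
  ∀ r : σ → List (Σ x : S.X, S.O x), (∀ Q, r Q ∈ Q.1.runs) → S.Consistent r →
    S.support r ∈ S.contexts

theorem Protocol.nil_mem {S : Scenario.{u}} (Q : S.Protocol) : [] ∈ Q.runs := by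
  obtain ⟨l, hl⟩ := Q.nonempty
  exact Q.prefix_mem [] l hl

theorem IsRun.length_le {S : Scenario.{u}} {l : List (Σ x : S.X, S.O x)} (h : S.IsRun l) :
    l.length ≤ Nat.card S.X := by
  have := S.finX
  have := Fintype.ofFinite S.X
  have := h.1.length_le_card
  rw [Nat.card_eq_fintype_card]
  simpa using this

theorem finite_isRun (S : Scenario.{u}) : {l | S.IsRun l}.Finite := by
  have := S.finX
  have := S.finO
  exact (List.finite_length_le (Σ x : S.X, S.O x) (Nat.card S.X)).subset fun l hl => hl.length_le

theorem finite_protocol (S : Scenario.{u}) : Finite S.Protocol := by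
  have h := S.finite_isRun.finite_subsets
  have : Finite {A : Set (List (Σ x : S.X, S.O x)) // A ⊆ {l | S.IsRun l}} := h.to_subtype
  exact Finite.of_injective
    (fun Q : S.Protocol =>
      (⟨Q.runs, Q.isRun⟩ : {A : Set (List (Σ x : S.X, S.O x)) // A ⊆ {l | S.IsRun l}}))
    fun Q R h => Protocol.ext (congrArg Subtype.val h)

theorem Protocol.finite_outcome {S : Scenario.{u}} (Q : S.Protocol) : Finite Q.Outcome :=
  Set.Finite.to_subtype (s := {l | l ∈ Q.runs ∧ ∀ m ∈ Q.runs, l <+: m → m = l})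
    (S.finite_isRun.subset fun l hl => Q.isRun l hl.1)

theorem Protocol.nonempty_outcome {S : Scenario.{u}} (Q : S.Protocol) : Nonempty Q.Outcome := by
  have hf : Q.runs.Finite := S.finite_isRun.subset Q.isRun
  obtain ⟨l, hl, hmax⟩ := Set.exists_max_image Q.runs List.length hf Q.nonempty
  exact ⟨l, hl, fun m hm h => (h.eq_of_length_le (hmax m hm)).symm⟩

/-- The scenario whose measurements are the measurement protocols on `S`. -/
abbrev MP (S : Scenario.{u}) : Scenario.{u} where
  X := S.Protocol
  finX := S.finite_protocol
  O := Protocol.Outcome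
  finO := Protocol.finite_outcome
  nonemptyO := Protocol.nonempty_outcome
  contexts := {σ | S.CompatibleProtocols σ}
  contexts_nonempty := by
    refine ⟨∅, fun r _ _ => ?_⟩
    have : S.support r = ∅ := by
      ext x
      simp [support]
    rw [this]
    exact S.empty_mem_contexts
  contexts_down := by
    classical
    intro σ hσ τ h r hr hc
    let r' : σ → List (Σ x : S.X, S.O x) := fun Q => if hQ : Q.1 ∈ τ then r ⟨Q.1, hQ⟩ else []
    have key : ∀ Q p, p ∈ r' Q → ∃ R : τ, p ∈ r R := by
      intro Q p hp
      by_cases hQ : Q.1 ∈ τ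
      · exact ⟨⟨Q.1, hQ⟩, by simpa [r', hQ] using hp⟩
      · simp [r', hQ] at hp
    refine S.contexts_down _ (hσ r' ?_ ?_) _ ?_
    · intro Q
      by_cases hQ : Q.1 ∈ τ
      · simpa [r', hQ] using hr ⟨Q.1, hQ⟩
      · simpa [r', hQ] using Q.1.nil_mem
    · intro i j x o o' h1 h2
      obtain ⟨R, hR⟩ := key i _ h1
      obtain ⟨R', hR'⟩ := key j _ h2
      exact hc R R' x o o' hR hR'
    · rintro x ⟨o, Q, hQ⟩
      exact ⟨o, ⟨Q.1, h Q.2⟩, by simpa [r', Q.2] using hQ⟩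
  contexts_singleton := by
    intro Q r hr _
    refine S.contexts_down _ (Q.isRun _ (hr ⟨Q, rfl⟩)).2 _ ?_
    rintro x ⟨o, ⟨R, hR⟩, hx⟩
    obtain rfl : R = Q := hR
    exact ⟨o, hx⟩

end Scenario

/-! ### The model of measurement protocols -/

namespace EmpiricalModel

variable {S : Scenario.{u}}

open Classical in
/-- The probability of a joint outcome `s` of a compatible set of protocols: the probability that
`e` gives to the union of the maximal runs `s Q` if these are pairwise consistent, and `0`
otherwise. -/
noncomputable def mpWeight (e : EmpiricalModel S) (σ : Set S.Protocol)
    (hσ : S.CompatibleProtocols σ) (s : S.MP.Assignment σ) : ENNReal :=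
  if h : S.Consistent (fun Q : σ => (s Q).1) then
    e.prob (S.support fun Q : σ => (s Q).1) (hσ _ (fun Q => (s Q).2.1) h)
      (S.union fun Q : σ => (s Q).1)
  else 0

/-- The measurements that occur in a set of pairs. -/
def dom (A : Set (Σ x : S.X, S.O x)) : Set S.X := {x | ∃ o, ⟨x, o⟩ ∈ A}

/-- A set of pairs is functional if it has at most one outcome for each measurement. -/
def Functional (A : Set (Σ x : S.X, S.O x)) : Prop := ∀ x o o', ⟨x, o⟩ ∈ A → ⟨x, o'⟩ ∈ A → o = o'

open Classical in
/-- The probability that `e` gives to a partial assignment, given as a set of pairs. -/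
noncomputable def weight (e : EmpiricalModel S) (A : Set (Σ x : S.X, S.O x)) : ENNReal :=
  if h : Functional A ∧ dom A ∈ S.contexts then e.prob (dom A) h.2 (fun x => x.2.choose) else 0

theorem weight_of_not (e : EmpiricalModel S) {A : Set (Σ x : S.X, S.O x)} (h : ¬ Functional A) :
    e.weight A = 0 := by
  unfold weight
  rw [dif_neg]
  exact fun h' => h h'.1

theorem prob_congr (e : EmpiricalModel S) {σ τ : Set S.X} (h : σ = τ) (hσ : σ ∈ S.contexts)
    (hτ : τ ∈ S.contexts) (s : S.Assignment σ) (t : S.Assignment τ)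
    (hst : ∀ x (h1 : x ∈ σ) (h2 : x ∈ τ), s ⟨x, h1⟩ = t ⟨x, h2⟩) :
    e.prob σ hσ s = e.prob τ hτ t := by
  subst h
  congr 1
  funext x
  exact hst x.1 x.2 x.2

theorem weight_eq (e : EmpiricalModel S) {A : Set (Σ x : S.X, S.O x)} (h : Functional A)
    {σ : Set S.X} (hσ : σ ∈ S.contexts) (hd : dom A = σ) (s : S.Assignment σ)
    (hs : ∀ x : σ, ⟨x.1, s x⟩ ∈ A) : e.weight A = e.prob σ hσ s := by
  subst hd
  unfold weight
  rw [dif_pos ⟨h, hσ⟩]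
  congr 1
  funext x
  exact h x.1 _ _ x.2.choose_spec (hs x)

theorem weight_empty (e : EmpiricalModel S) : e.weight ∅ = 1 := by
  have hd : dom (∅ : Set (Σ x : S.X, S.O x)) = ∅ := by
    ext x
    simp [dom]
  rw [e.weight_eq (fun x o o' h => h.elim) S.empty_mem_contexts hd (fun x => x.2.elim)
    (fun x => x.2.elim)]
  have h := (e.prob ∅ S.empty_mem_contexts).tsum_coe
  rw [tsum_eq_single (fun x => x.2.elim) ?_] at h
  · exact h
  · intro b hb
    exact absurd (funext fun x => x.2.elim) hb

/-- No-signalling for one more measurement. -/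
theorem weight_insert (e : EmpiricalModel S) {A : Set (Σ x : S.X, S.O x)} (h : Functional A)
    {x : S.X} (hx : x ∉ dom A) (hd : insert x (dom A) ∈ S.contexts) :
    ∑' o : S.O x, e.weight (insert ⟨x, o⟩ A) = e.weight A := by
  classical
  have hA : dom A ∈ S.contexts := S.contexts_down _ hd _ (Set.subset_insert _ _)
  choose g hg using fun y : dom A => y.2
  let ext (o : S.O x) : S.Assignment (insert x (dom A)) := fun y =>
    if hy : y.1 = x then cast (congrArg S.O hy.symm) o else g ⟨y.1, y.2.resolve_left hy⟩
  have ext_self : ∀ o h, ext o ⟨x, h⟩ = o := by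
    intro o h
    simp [ext]
  have ext_old : ∀ o (y : dom A), ext o ⟨y.1, Or.inr y.2⟩ = g y := by
    intro o y
    have : y.1 ≠ x := fun hy => hx (hy ▸ y.2)
    simp [ext, this]
  have hw : ∀ o, e.weight (insert ⟨x, o⟩ A) = e.prob _ hd (ext o) := by
    intro o
    apply e.weight_eq
    · rintro y p p' (h1 | h1) (h2 | h2)
      · rw [Sigma.mk.injEq] at h1 h2
        obtain ⟨rfl, h1⟩ := h1
        exact (eq_of_heq h1).trans (eq_of_heq h2.2).symm
      · rw [Sigma.mk.injEq] at h1
        obtain ⟨rfl, h1⟩ := h1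
        exact absurd ⟨_, h2⟩ hx
      · rw [Sigma.mk.injEq] at h2
        obtain ⟨rfl, h2⟩ := h2
        exact absurd ⟨_, h1⟩ hx
      · exact h y p p' h1 h2
    · ext y
      constructor
      · rintro ⟨p, hp | hp⟩
        · rw [Sigma.mk.injEq] at hp
          exact Or.inl hp.1
        · exact Or.inr ⟨p, hp⟩
      · rintro (rfl | ⟨p, hp⟩)
        · exact ⟨o, Or.inl rfl⟩
        · exact ⟨p, Or.inr hp⟩
    · rintro ⟨y, hy⟩
      by_cases hyx : y = x
      · subst hyx
        rw [ext_self]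
        exact Or.inl rfl
      · have hy' : y ∈ dom A := hy.resolve_left hyx
        exact Or.inr ((ext_old o ⟨y, hy'⟩) ▸ hg ⟨y, hy'⟩)
  rw [e.weight_eq h hA rfl g hg, ← e.compatible _ _ hd hA (Set.subset_insert _ _), PMF.map_apply]
  simp_rw [hw]
  have hinj : Function.Injective ext := by
    intro o o' hoo
    rw [← ext_self o (Or.inl rfl), ← ext_self o' (Or.inl rfl), hoo]
  rw [← hinj.tsum_eq]
  · refine tsum_congr fun o => ?_
    rw [if_pos]
    funext y
    exact (ext_old o y).symm
  · intro s hs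
    refine ⟨s ⟨x, Or.inl rfl⟩, ?_⟩
    have hgs : g = S.restrict (Set.subset_insert _ _) s := by
      by_contra hne
      exact hs (if_neg hne)
    funext ⟨y, hy⟩
    by_cases hyx : y = x
    · subst hyx
      exact ext_self _ _
    · have hy' : y ∈ dom A := hy.resolve_left hyx
      exact (ext_old _ ⟨y, hy'⟩).trans (congrFun hgs ⟨y, hy'⟩)

open Classical in
/-- Running a protocol to its end does not change the total probability. -/
theorem weight_protocol (e : EmpiricalModel S) (Q : S.Protocol) (A : Set (Σ x : S.X, S.O x))
    (hQ : ∀ l ∈ Q.runs, Functional (A ∪ {p | p ∈ l}) → dom (A ∪ {p | p ∈ l}) ∈ S.contexts)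
    (n : ℕ) (l : List (Σ x : S.X, S.O x)) (hl : l ∈ Q.runs) (hn : Nat.card S.X ≤ l.length + n)
    (hf : Functional (A ∪ {p | p ∈ l})) :
    ∑' r : Q.Outcome, (if l <+: r.1 then e.weight (A ∪ {p | p ∈ r.1}) else 0) =
      e.weight (A ∪ {p | p ∈ l}) := by
  induction n generalizing l with
  | zero =>
    have hmax : ∀ m ∈ Q.runs, l <+: m → m = l := by
      intro m hm h
      have := (Q.isRun m hm).length_le
      exact (h.eq_of_length_le (by omega)).symm
    rw [tsum_eq_single ⟨l, hl, hmax⟩]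
    · simp
    · intro r hr
      rw [if_neg]
      intro h
      exact hr (Subtype.ext (hmax r.1 r.2.1 h))
  | succ n ih =>
    by_cases hmax : ∀ m ∈ Q.runs, l <+: m → m = l
    · rw [tsum_eq_single ⟨l, hl, hmax⟩]
      · simp
      · intro r hr
        rw [if_neg]
        intro h
        exact hr (Subtype.ext (hmax r.1 r.2.1 h))
    · push Not at hmax
      obtain ⟨m, hm, ⟨k, rfl⟩, hne⟩ := hmax
      obtain _ | ⟨⟨x, o⟩, k⟩ := k
      · simp at hne
      have hx : l ++ [⟨x, o⟩] ∈ Q.runs := Q.prefix_mem _ k (by simpa using hm)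
      have hall := Q.all_outcomes l x o hx
      have hset : ∀ o', A ∪ {p | p ∈ l ++ [⟨x, o'⟩]} = insert ⟨x, o'⟩ (A ∪ {p | p ∈ l}) := by
        intro o'
        ext p
        simp only [List.mem_append, List.mem_singleton, Set.mem_union, Set.mem_ofPred_eq,
          Set.mem_insert_iff]
        tauto
      have step : ∀ r : Q.Outcome,
          (if l <+: r.1 then e.weight (A ∪ {p | p ∈ r.1}) else 0) =
            ∑' o' : S.O x, if l ++ [⟨x, o'⟩] <+: r.1 then e.weight (A ∪ {p | p ∈ r.1}) else 0 := by
        intro r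
        by_cases hr : l <+: r.1
        · obtain ⟨t, ht⟩ := hr
          obtain _ | ⟨⟨x', o'⟩, t⟩ := t
          · have := r.2.2 _ hm ⟨⟨x, o⟩ :: k, by rw [← ht]; simp⟩
            rw [← ht] at this
            simp at this
          · have hx' : l ++ [⟨x', o'⟩] ∈ Q.runs :=
              Q.prefix_mem _ t (by simpa [ht] using r.2.1)
            obtain rfl := Q.determinate l x o x' o' hx hx'
            rw [if_pos ⟨_, ht⟩, tsum_eq_single o']
            · rw [if_pos ⟨t, by simpa using ht⟩]
            · intro o'' ho
              rw [if_neg]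
              rintro ⟨t', ht'⟩
              rw [← ht] at ht'
              simp at ht'
              exact ho ht'.1
        · rw [if_neg hr]
          symm
          rw [ENNReal.tsum_eq_zero]
          intro o'
          rw [if_neg]
          intro h
          exact hr ((List.prefix_append _ _).trans h)
      simp_rw [step]
      rw [ENNReal.tsum_comm]
      have step2 : ∀ o' : S.O x, ∑' r : Q.Outcome,
          (if l ++ [⟨x, o'⟩] <+: r.1 then e.weight (A ∪ {p | p ∈ r.1}) else 0) =
            e.weight (insert ⟨x, o'⟩ (A ∪ {p | p ∈ l})) := by
        intro o'
        by_cases hf' : Functional (A ∪ {p | p ∈ l ++ [⟨x, o'⟩]})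
        · rw [ih _ (hall o') (by simp; omega) hf', hset]
        · rw [← hset, e.weight_of_not hf', ENNReal.tsum_eq_zero]
          intro r
          split_ifs with hr
          · apply e.weight_of_not
            intro hF
            refine hf' fun y p p' h1 h2 => hF y p p' ?_ ?_
            · exact h1.imp id fun h => hr.subset h
            · exact h2.imp id fun h => hr.subset h
          · rfl
      simp_rw [step2]
      by_cases hxd : x ∈ dom (A ∪ {p | p ∈ l})
      · obtain ⟨o1, ho1⟩ := hxd
        rw [tsum_eq_single o1, Set.insert_eq_of_mem ho1]
        intro o' ho'
        apply e.weight_of_not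
        intro hF
        exact ho' (hF x o' o1 (Or.inl rfl) (Or.inr ho1))
      · apply e.weight_insert hf hxd
        have hF : Functional (A ∪ {p | p ∈ l ++ [⟨x, o⟩]}) := by
          rw [hset]
          rintro y p p' (h1 | h1) (h2 | h2)
          · rw [Sigma.mk.injEq] at h1 h2
            obtain ⟨rfl, h1⟩ := h1
            exact (eq_of_heq h1).trans (eq_of_heq h2.2).symm
          · rw [Sigma.mk.injEq] at h1
            obtain ⟨rfl, h1⟩ := h1
            exact absurd ⟨_, h2⟩ hxd
          · rw [Sigma.mk.injEq] at h2
            obtain ⟨rfl, h2⟩ := h2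
            exact absurd ⟨_, h1⟩ hxd
          · exact hf y p p' h1 h2
        have := hQ _ hx hF
        rw [hset] at this
        refine S.contexts_down _ this _ ?_
        rintro y (rfl | ⟨p, hp⟩)
        · exact ⟨o, Or.inl rfl⟩
        · exact ⟨p, Or.inr hp⟩

theorem mpWeight_eq (e : EmpiricalModel S) (σ : Set S.Protocol)
    (hσ : S.CompatibleProtocols σ) (s : S.MP.Assignment σ) :
    e.mpWeight σ hσ s = e.weight {p | ∃ Q : σ, p ∈ (s Q).1} := by
  unfold mpWeight
  split_ifs with h
  · symm
    apply e.weight_eq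
    · rintro x o o' ⟨Q, hQ⟩ ⟨R, hR⟩
      exact h Q R x o o' hQ hR
    · rfl
    · exact fun x => x.2.choose_spec
  · symm
    apply e.weight_of_not
    exact fun h' => h fun Q R x o o' h1 h2 => h' x o o' ⟨Q, h1⟩ ⟨R, h2⟩

/-- No-signalling for one more protocol. -/
theorem mpWeight_insert (e : EmpiricalModel S) (σ : Set S.Protocol) (Q : S.Protocol)
    (hQ : Q ∉ σ) (hσ : S.CompatibleProtocols (insert Q σ)) (t : S.MP.Assignment σ)
    (c : S.MP.Assignment σ → Q.Outcome → S.MP.Assignment (insert Q σ))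
    (hc : ∀ t r, c t r ⟨Q, Or.inl rfl⟩ = r)
    (hc' : ∀ t r (P : σ), c t r ⟨P.1, Or.inr P.2⟩ = t P) :
    ∑' r, e.mpWeight _ hσ (c t r) =
      e.mpWeight σ (S.MP.contexts_down _ hσ _ (Set.subset_insert _ _)) t := by
  classical
  simp_rw [mpWeight_eq]
  set A : Set (Σ x : S.X, S.O x) := {p | ∃ P : σ, p ∈ (t P).1} with hA
  have hset : ∀ r : Q.Outcome, {p | ∃ P : (insert Q σ : Set S.Protocol), p ∈ (c t r P).1} =
      A ∪ {p | p ∈ r.1} := by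
    intro r
    ext p
    constructor
    · rintro ⟨⟨P, rfl | hP⟩, hp⟩
      · rw [hc] at hp
        exact Or.inr hp
      · rw [hc' t r ⟨P, hP⟩] at hp
        exact Or.inl ⟨⟨P, hP⟩, hp⟩
    · rintro (⟨P, hp⟩ | hp)
      · exact ⟨⟨P.1, Or.inr P.2⟩, by rw [hc']; exact hp⟩
      · exact ⟨⟨Q, Or.inl rfl⟩, by rw [hc]; exact hp⟩
  have hset' : A ∪ {p | p ∈ ([] : List (Σ x : S.X, S.O x))} = A := by simp
  by_cases hf : Functional A
  · have := e.weight_protocol Q A ?_ (Nat.card S.X) [] Q.nil_mem (by simp) (by rwa [hset'])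
    · simp only [List.nil_prefix, if_true, hset'] at this
      simp_rw [hset]
      exact this
    · intro l hl hF
      let r : ↥(insert Q σ : Set S.Protocol) → List (Σ x : S.X, S.O x) := fun P =>
        if h : P.1 ∈ σ then (t ⟨P.1, h⟩).1 else l
      have hr : ∀ P p, p ∈ r P → p ∈ A ∪ {p | p ∈ l} := by
        intro P p hp
        by_cases h : P.1 ∈ σ
        · exact Or.inl ⟨⟨P.1, h⟩, by simpa [r, h] using hp⟩
        · exact Or.inr (by simpa [r, h] using hp)
      refine S.contexts_down _ (hσ r ?_ ?_) _ ?_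
      · rintro ⟨P, hP⟩
        by_cases h : P ∈ σ
        · simpa [r, h] using (t ⟨P, h⟩).2.1
        · obtain rfl := hP.resolve_right h
          simpa [r, h] using hl
      · intro P R x o o' h1 h2
        exact hF x o o' (hr P _ h1) (hr R _ h2)
      · rintro x ⟨o, ⟨P, hp⟩ | hp⟩
        · exact ⟨o, ⟨P.1, Or.inr P.2⟩, by simpa [r, P.2] using hp⟩
        · exact ⟨o, ⟨Q, Or.inl rfl⟩, by simpa [r, hQ] using hp⟩
  · rw [e.weight_of_not hf, ENNReal.tsum_eq_zero]
    intro r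
    rw [hset]
    apply e.weight_of_not
    exact fun hF => hf fun x o o' h1 h2 => hF x o o' (Or.inl h1) (Or.inl h2)

open Classical in
theorem mpWeight_marginal (e : EmpiricalModel S) (τ : Set S.Protocol)
    (hτ : S.CompatibleProtocols τ) (t : S.MP.Assignment τ) (σ : Set S.Protocol)
    (hσ : S.CompatibleProtocols σ) (h : τ ⊆ σ) :
    ∑' s : S.MP.Assignment σ, (if t = S.MP.restrict h s then e.mpWeight σ hσ s else 0) =
      e.mpWeight τ hτ t := by
  have := S.finite_protocol
  suffices H : ∀ ρ : Set S.Protocol, ∀ (σ : Set S.Protocol) (hσ : S.CompatibleProtocols σ)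
      (h : τ ⊆ σ), σ \ τ = ρ →
      ∑' s : S.MP.Assignment σ, (if t = S.MP.restrict h s then e.mpWeight σ hσ s else 0) =
        e.mpWeight τ hτ t from H _ σ hσ h rfl
  intro ρ
  induction ρ, ρ.toFinite using Set.Finite.induction_on with
  | empty =>
    intro σ hσ h hd
    obtain rfl : σ = τ := (Set.sdiff_eq_empty.mp hd).antisymm h
    rw [tsum_eq_single t]
    · exact if_pos rfl
    · intro s hs
      rw [if_neg]
      exact fun h => hs h.symm
  | @insert Q ρ hQ _ ih =>
    intro σ hσ h hd
    obtain ⟨σ', hQσ', rfl⟩ : ∃ σ', Q ∉ σ' ∧ σ = insert Q σ' := by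
      have hQσ : Q ∈ σ := by
        have : Q ∈ σ \ τ := hd ▸ Set.mem_insert _ _
        exact this.1
      exact ⟨σ \ {Q}, by simp, by simp [Set.insert_eq_of_mem hQσ]⟩
    have hQτ : Q ∉ τ := by
      have : Q ∈ insert Q σ' \ τ := hd ▸ Set.mem_insert _ _
      exact this.2
    have hτσ' : τ ⊆ σ' := fun P hP => (h hP).resolve_left (fun h => hQτ (h ▸ hP))
    have hd' : σ' \ τ = ρ := by
      ext P
      have hP := Set.ext_iff.mp hd P
      simp only [Set.mem_sdiff, Set.mem_insert_iff] at hP ⊢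
      by_cases hPQ : P = Q
      · subst hPQ
        tauto
      · tauto
    let c : S.MP.Assignment σ' → Q.Outcome → S.MP.Assignment (insert Q σ') := fun t r P =>
      if hP : P.1 = Q then cast (congrArg Scenario.Protocol.Outcome hP.symm) r else t ⟨P.1, P.2.resolve_left hP⟩
    have hc : ∀ t r, c t r ⟨Q, Or.inl rfl⟩ = r := by
      intro t r
      simp [c]
    have hc' : ∀ t r (P : σ'), c t r ⟨P.1, Or.inr P.2⟩ = t P := by
      intro t r P
      have : P.1 ≠ Q := fun hP => hQσ' (hP ▸ P.2)
      simp [c, this]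
    let E : S.MP.Assignment σ' × Q.Outcome ≃ S.MP.Assignment (insert Q σ') :=
      { toFun := fun p => c p.1 p.2
        invFun := fun s => (fun P => s ⟨P.1, Or.inr P.2⟩, s ⟨Q, Or.inl rfl⟩)
        left_inv := by
          rintro ⟨t, r⟩
          exact Prod.ext (funext fun P => hc' t r P) (hc t r)
        right_inv := by
          intro s
          funext ⟨P, hP⟩
          by_cases hPQ : P = Q
          · subst hPQ
            exact hc _ _
          · exact hc' _ _ ⟨P, hP.resolve_left hPQ⟩ }
    have hE : ∀ p, E p = c p.1 p.2 := fun p => rfl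
    have hres : ∀ s r, S.MP.restrict h (c s r) = S.MP.restrict hτσ' s := by
      intro s r
      funext P
      exact hc' s r ⟨P.1, hτσ' P.2⟩
    rw [← E.tsum_eq, ENNReal.tsum_prod']
    simp_rw [hE, hres]
    rw [← ih σ' (S.MP.contexts_down _ hσ _ (Set.subset_insert _ _)) hτσ' hd']
    refine tsum_congr fun s => ?_
    by_cases hs : t = S.MP.restrict hτσ' s
    · simp_rw [if_pos hs]
      exact e.mpWeight_insert σ' Q hQσ' hσ s c hc hc'
    · simp_rw [if_neg hs]
      exact tsum_zero

theorem mpWeight_tsum (e : EmpiricalModel S) (σ : Set S.Protocol)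
    (hσ : S.CompatibleProtocols σ) : ∑' s : S.MP.Assignment σ, e.mpWeight σ hσ s = 1 := by
  classical
  have he : S.CompatibleProtocols ∅ := S.MP.empty_mem_contexts
  have h := e.mpWeight_marginal ∅ he (fun P => P.2.elim) σ hσ (Set.empty_subset _)
  rw [mpWeight_eq] at h
  have h0 : {p : Σ x : S.X, S.O x | ∃ P : (∅ : Set S.Protocol),
      p ∈ ((fun P => P.2.elim : S.MP.Assignment ∅) P).1} = ∅ := by
    ext p
    simp
  rw [h0, weight_empty] at h
  rw [← h]
  refine tsum_congr fun s => ?_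
  rw [if_pos]
  funext P
  exact P.2.elim

/-- The distribution on the joint outcomes of a compatible set of protocols. -/
noncomputable def mpProb (e : EmpiricalModel S) (σ : Set S.Protocol)
    (hσ : S.CompatibleProtocols σ) : PMF (S.MP.Assignment σ) :=
  ⟨e.mpWeight σ hσ, (e.mpWeight_tsum σ hσ) ▸ ENNReal.summable.hasSum⟩

/-- The empirical model on measurement protocols induced by `e`. -/
noncomputable def MP (e : EmpiricalModel S) : EmpiricalModel S.MP where
  prob := e.mpProb
  compatible := by
    classical
    intro σ τ hσ hτ h
    ext t
    rw [PMF.map_apply]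
    refine Eq.trans (tsum_congr fun s => ?_) (e.mpWeight_marginal τ hτ t σ hσ h)
    rfl

end EmpiricalModel

/-- `d` simulates `e`: for some non-contextual model `c` there is a deterministic morphism that
pushes the measurement protocols on `d ⊗ c` forward to `e`. -/
def EmpiricalModel.Simulates {T S : Scenario.{u}} (d : EmpiricalModel T)
    (e : EmpiricalModel S) : Prop :=
  ∃ (R : Scenario.{u}) (c : EmpiricalModel R), c.NonContextual ∧
    ∃ m : DetMorphism (T.tensor R).MP S, e = EmpiricalModel.push m (d.tensor c).MP

/-! Every empirical model is the family of marginals of a signed measure on global assignments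
(`exists_isExtension`), and it is non-contextual iff this measure can be chosen to be a probability
distribution (`nonContextual_iff`). Signed extensions pass through tensor products with
non-contextual models, measurement protocols and deterministic morphisms, so one may argue as if all
outcomes existed in advance.

Seen this way, a simulation of `e ⊗ e` by `e` is, for each value of the shared randomness, a map
from one global assignment to two. Each value in a copy is determined by adaptively chosen
measurements of the original, and one context in each copy together uses only one context of the
original (`Broadcast`). Each copy has the marginals of `e`, so the second one can be cloned again,
giving `n` copies for every `n` (`Broadcastable.exists_card`).

For fixed randomness there are only finitely many ways for a copy to depend on the original. If more
than `|X|` copies do so in the same way, measuring a different `x` in each of them shows that all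
measurements of such a copy are determined by one context of the original. Hence all but at most `K`
copies, with `K` independent of `n`, are jointly measurable (`Broadcast.card_not_mem_le`), and the
signed measure induces a genuine probability distribution on them. Averaging over the jointly
measurable copies gives a subdistribution below `e` of mass at least `1 - K / n`; let `n` grow and
use compactness (`nonContextual_of_subprobability`).

Conversely, if `e` is non-contextual then so is `e ⊗ e`, which can itself serve as the auxiliary
model (`NonContextual.simulates`). -/

/-! ### Expectations -/

namespace PMF

variable {α β : Type*} [Finite α] [Finite β]

/-- The expectation of real functions on a finite type. -/
noncomputable def expect (p : PMF α) : (α → ℝ) →ₗ[ℝ] ℝ :=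
  letI := Fintype.ofFinite α
  ∑ a, (p a).toReal • LinearMap.proj a

theorem expect_apply [h : Fintype α] (p : PMF α) (g : α → ℝ) :
    p.expect g = ∑ a, (p a).toReal * g a := by
  obtain rfl : h = Fintype.ofFinite α := Subsingleton.elim _ _
  simp [expect]

theorem sum_toReal {α : Type*} [Fintype α] (p : PMF α) : ∑ a, (p a).toReal = 1 := by
  rw [← ENNReal.toReal_sum fun a _ => p.apply_ne_top a, ← tsum_fintype (L := .unconditional _),
    p.tsum_coe, ENNReal.toReal_one]

theorem expect_const (p : PMF α) (r : ℝ) : p.expect (fun _ => r) = r := by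
  have := Fintype.ofFinite α
  rw [expect_apply, ← Finset.sum_mul, sum_toReal, one_mul]

open Classical in
theorem expect_single (p : PMF α) (a : α) :
    p.expect (fun b => if b = a then 1 else 0) = (p a).toReal := by
  have := Fintype.ofFinite α
  simp [expect_apply]

theorem expect_pure (a : α) (g : α → ℝ) : (PMF.pure a).expect g = g a := by
  classical
  have := Fintype.ofFinite α
  rw [expect_apply, Finset.sum_eq_single a] <;> simp +contextual [PMF.pure_apply]

theorem expect_bind (p : PMF α) (f : α → PMF β) (g : β → ℝ) :
    (p.bind f).expect g = p.expect fun a => (f a).expect g := by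
  have := Fintype.ofFinite α
  have := Fintype.ofFinite β
  simp_rw [expect_apply, PMF.bind_apply, tsum_fintype]
  have (b : β) : (∑ a, p a * f a b).toReal = ∑ a, (p a).toReal * (f a b).toReal := by
    rw [ENNReal.toReal_sum fun a _ => ENNReal.mul_ne_top (p.apply_ne_top a) ((f a).apply_ne_top b)]
    simp
  simp_rw [this, Finset.sum_mul, Finset.mul_sum]
  rw [Finset.sum_comm]
  simp_rw [mul_assoc]

theorem expect_map (p : PMF α) (f : α → β) (g : β → ℝ) :
    (p.map f).expect g = p.expect fun a => g (f a) := by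
  rw [← PMF.bind_pure_comp, expect_bind]
  simp [expect_pure]

theorem expect_comm (p : PMF α) (q : PMF β) (g : α → β → ℝ) :
    (p.expect fun a => q.expect (g a)) = q.expect fun b => p.expect fun a => g a b := by
  have := Fintype.ofFinite α
  have := Fintype.ofFinite β
  simp_rw [expect_apply, Finset.mul_sum]
  rw [Finset.sum_comm]
  simp_rw [mul_left_comm]

theorem expect_mono (p : PMF α) {f g : α → ℝ} (h : ∀ a, f a ≤ g a) :
    p.expect f ≤ p.expect g := by
  have := Fintype.ofFinite α
  rw [expect_apply, expect_apply]
  exact Finset.sum_le_sum fun a _ => mul_le_mul_of_nonneg_left (h a) ENNReal.toReal_nonneg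

theorem ext_of_expect {p q : PMF α} (h : ∀ g, p.expect g = q.expect g) : p = q := by
  classical
  ext a
  have := h fun b => if b = a then 1 else 0
  rwa [expect_single, expect_single,
    ENNReal.toReal_eq_toReal_iff' (p.apply_ne_top a) (q.apply_ne_top a)] at this

end PMF

/-! ### Global assignments and extensions of models -/

namespace Scenario

instance finite_X (S : Scenario.{u}) : Finite S.X := S.finX

instance finite_O (S : Scenario.{u}) (x : S.X) : Finite (S.O x) := S.finO x

instance nonempty_O (S : Scenario.{u}) (x : S.X) : Nonempty (S.O x) := S.nonemptyO x

instance finite_O_tensor (S T : Scenario.{u}) (x : S.X ⊕ T.X) : Finite (Sum.elim S.O T.O x) :=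
  (S.tensor T).finO x

instance instFinite_protocol (S : Scenario.{u}) : Finite S.Protocol := S.finite_protocol

instance instFinite_outcome {S : Scenario.{u}} (Q : S.Protocol) : Finite Q.Outcome := Q.finite_outcome

/-- Assignments of outcomes to all measurements. -/
abbrev Global (S : Scenario.{u}) : Type u := (x : S.X) → S.O x

/-- Restriction of a global assignment to a set of measurements. -/
def proj (S : Scenario.{u}) (U : Set S.X) (s : S.Global) : S.Assignment U := fun x => s x.1

open Classical in
/-- Extend a joint outcome by the values of a given global assignment. -/
noncomputable def extend {S : Scenario.{u}} (d : S.Global) {U : Set S.X} (t : S.Assignment U) :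
    S.Global :=
  fun x => if h : x ∈ U then t ⟨x, h⟩ else d x

theorem proj_extend {S : Scenario.{u}} (d : S.Global) {U : Set S.X} (t : S.Assignment U) :
    S.proj U (extend d t) = t := by
  funext x
  simp [proj, extend]

theorem proj_eq_iff {S : Scenario.{u}} {U : Set S.X} {s s' : S.Global} :
    S.proj U s = S.proj U s' ↔ ∀ x ∈ U, s x = s' x :=
  ⟨fun h x hx => congrFun h ⟨x, hx⟩, fun h => funext fun x => h x.1 x.2⟩

end Scenario

namespace EmpiricalModel

variable {S T : Scenario.{u}}

/-- A linear functional on functions of global assignments (a signed measure) that has the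
given distributions as marginals on all contexts. -/
def IsExtension (e : EmpiricalModel S) (φ : (S.Global → ℝ) →ₗ[ℝ] ℝ) : Prop :=
  ∀ (σ : Set S.X) (hσ : σ ∈ S.contexts) (g : S.Assignment σ → ℝ),
    φ (fun s => g (S.proj σ s)) = (e.prob σ hσ).expect g

/-- This turns an equality of models into an equality of functionals on global assignments. -/
theorem IsExtension.unique {e e' : EmpiricalModel S} {φ : (S.Global → ℝ) →ₗ[ℝ] ℝ}
    (h : e.IsExtension φ) (h' : e'.IsExtension φ) : e = e' := by
  ext1
  funext σ hσ
  exact PMF.ext_of_expect fun g => (h σ hσ g).symm.trans (h' σ hσ g)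

theorem IsExtension.const {e : EmpiricalModel S} {φ : (S.Global → ℝ) →ₗ[ℝ] ℝ}
    (h : e.IsExtension φ) (r : ℝ) : φ (fun _ => r) = r :=
  (h ∅ S.empty_mem_contexts fun _ => r).trans (PMF.expect_const _ r)

open Classical in
theorem IsExtension.cylinder {e : EmpiricalModel S} {φ : (S.Global → ℝ) →ₗ[ℝ] ℝ}
    (h : e.IsExtension φ) {σ : Set S.X} (hσ : σ ∈ S.contexts) (t : S.Assignment σ) :
    φ (fun s => if S.proj σ s = t then 1 else 0) = (e.prob σ hσ t).toReal :=
  (h σ hσ fun b => if b = t then 1 else 0).trans (PMF.expect_single _ t)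

theorem nonContextual_iff {e : EmpiricalModel S} :
    e.NonContextual ↔ ∃ p : PMF S.Global, e.IsExtension p.expect := by
  constructor
  · rintro ⟨d, hd⟩
    refine ⟨d.map fun s x => s ⟨x, trivial⟩, fun σ hσ g => ?_⟩
    rw [← hd σ hσ, PMF.expect_map, PMF.expect_map]
    rfl
  · rintro ⟨p, hp⟩
    refine ⟨p.map (S.proj Set.univ), fun σ hσ => PMF.ext_of_expect fun g => ?_⟩
    rw [PMF.expect_map, PMF.expect_map, ← hp σ hσ]
    rfl

/-- Every empirical model is the family of marginals of a signed measure. -/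
theorem exists_isExtension (e : EmpiricalModel S) : ∃ φ, e.IsExtension φ := by
  classical
  let d : S.Global := fun x => Classical.arbitrary _
  -- Marginals are corrected one cardinality at a time, starting from the zero functional.
  have key (k : ℕ) : ∃ φ : (S.Global → ℝ) →ₗ[ℝ] ℝ, ∀ (σ : Set S.X) (hσ : σ ∈ S.contexts),
      σ.ncard < k → ∀ g : S.Assignment σ → ℝ,
        φ (fun s => g (S.proj σ s)) = (e.prob σ hσ).expect g := by
    induction k with
    | zero => exact ⟨0, fun σ hσ h => absurd h (Nat.not_lt_zero _)⟩
    | succ k ih =>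
      obtain ⟨φ, hφ⟩ := ih
      have := Fintype.ofFinite {σ : Set S.X // σ ∈ S.contexts ∧ σ.ncard = k}
      -- The defect of `φ` on `σ`, placed on the global assignments that equal `d` outside `σ`.
      let ψ (σ : {σ : Set S.X // σ ∈ S.contexts ∧ σ.ncard = k}) : (S.Global → ℝ) →ₗ[ℝ] ℝ :=
        (e.prob σ.1 σ.2.1).expect ∘ₗ LinearMap.funLeft ℝ ℝ (Scenario.extend d) -
          φ ∘ₗ LinearMap.funLeft ℝ ℝ fun s => Scenario.extend d (S.proj σ.1 s)
      refine ⟨φ + ∑ σ, ψ σ, fun ρ hρ hk g => ?_⟩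
      -- On another context `ρ` of size at most `k` the correction sees only `σ ∩ ρ`, which has
      -- fewer than `k` elements; there `φ` is already right, by no-signalling.
      have hψ : ∀ σ, σ.1 ≠ ρ → ψ σ (fun s => g (S.proj ρ s)) = 0 := by
        rintro ⟨σ, hσ, hσk⟩ hne
        have hlt : (σ ∩ ρ).ncard < k := by
          refine (Set.ncard_lt_ncard (Set.inter_subset_left.ssubset_of_ne fun h => hne ?_)).trans_eq
            hσk
          exact Set.eq_of_subset_of_ncard_le (Set.inter_eq_left.mp h)
            ((Nat.lt_succ_iff.mp hk).trans_eq hσk.symm)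
        have hσρ : σ ∩ ρ ∈ S.contexts := S.contexts_down σ hσ _ Set.inter_subset_left
        let g' : S.Assignment (σ ∩ ρ) → ℝ := fun t => g (S.proj ρ (Scenario.extend d t))
        have h1 : ∀ t : S.Assignment σ, g (S.proj ρ (Scenario.extend d t)) =
            g' (S.restrict Set.inter_subset_left t) := by
          intro t
          refine congrArg g (funext fun x => ?_)
          by_cases hx : x.1 ∈ σ <;> simp [Scenario.proj, Scenario.extend, Scenario.restrict, hx]
        change (e.prob σ hσ).expect (fun t => g (S.proj ρ (Scenario.extend d t))) -
          φ (fun s => g (S.proj ρ (Scenario.extend d (S.proj σ s)))) = 0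
        simp_rw [h1]
        rw [← PMF.expect_map, e.compatible σ _ hσ hσρ]
        exact sub_eq_zero.mpr (hφ _ hσρ hlt g').symm
      rw [LinearMap.add_apply, LinearMap.sum_apply]
      by_cases hρk : ρ.ncard = k
      · rw [Finset.sum_eq_single ⟨ρ, hρ, hρk⟩ (fun σ _ h => hψ σ fun h' => h (Subtype.ext h'))
          (by simp)]
        change φ _ + ((e.prob ρ hρ).expect (fun t => g (S.proj ρ (Scenario.extend d t))) -
          φ (fun s => g (S.proj ρ (Scenario.extend d (S.proj ρ s))))) = _
        simp_rw [Scenario.proj_extend]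
        ring
      · rw [Finset.sum_eq_zero fun σ _ => hψ σ fun h => hρk (h ▸ σ.2.2), add_zero]
        exact hφ ρ hρ (by omega) g
  obtain ⟨φ, hφ⟩ := key (Nat.card S.X + 1)
  refine ⟨φ, fun σ hσ g => hφ σ hσ ?_ g⟩
  have := Set.ncard_le_card σ
  omega

/-! ### Transport of extensions -/

/-- The map on global assignments induced by a deterministic morphism. -/
def _root_.DetMorphism.mapGlobal (m : DetMorphism T S) (t : T.Global) : S.Global :=
  fun x => m.onOut x (t (m.onMeas x))

theorem IsExtension.push {d : EmpiricalModel T} {φ : (T.Global → ℝ) →ₗ[ℝ] ℝ}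
    (h : d.IsExtension φ) (m : DetMorphism T S) :
    (EmpiricalModel.push m d).IsExtension (φ ∘ₗ LinearMap.funLeft ℝ ℝ m.mapGlobal) := by
  intro σ hσ g
  refine Eq.trans ?_ (PMF.expect_map _ _ _).symm
  exact h _ (m.simplicial σ hσ) fun t => g (m.mapAssignment σ t)

/-- The global assignment on a tensor product given by a pair of global assignments. -/
def _root_.Scenario.pairGlobal (s : S.Global) (t : T.Global) : (S.tensor T).Global
  | Sum.inl x => s x
  | Sum.inr x => t x

/-- The product of a signed measure and a probability distribution. -/
noncomputable def _root_.Scenario.productFunctional (φ : (S.Global → ℝ) →ₗ[ℝ] ℝ)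
    (p : PMF T.Global) : ((S.tensor T).Global → ℝ) →ₗ[ℝ] ℝ where
  toFun f := p.expect fun t => φ fun s => f (Scenario.pairGlobal s t)
  map_add' f g := by
    rw [← map_add]
    congr 1
    funext t
    exact map_add φ _ _
  map_smul' r f := by
    rw [RingHom.id_apply, ← map_smul]
    congr 1
    funext t
    exact map_smul φ r _

theorem IsExtension.tensor {e : EmpiricalModel S} {φ : (S.Global → ℝ) →ₗ[ℝ] ℝ}
    (h : e.IsExtension φ) {c : EmpiricalModel T} {p : PMF T.Global} (hc : c.IsExtension p.expect) :
    (e.tensor c).IsExtension (Scenario.productFunctional φ p) := by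
  intro ρ hρ g
  change p.expect (fun t => φ fun s => g ((S.tensor T).proj ρ (Scenario.pairGlobal s t))) =
    PMF.expect (PMF.bind _ _) g
  simp_rw [PMF.expect_bind, PMF.expect_map]
  rw [PMF.expect_comm, ← hc _ hρ.2]
  congr 1
  funext t
  rw [← h _ hρ.1]
  congr 1
  funext s
  congr 1
  funext ⟨x, hx⟩
  cases x <;> rfl

/-- A context of the first factor is a context of the tensor product with empty second part; the
other factor then integrates to one. -/
theorem IsExtension.left {e : EmpiricalModel S} {c : EmpiricalModel T}
    {φ : ((S.tensor T).Global → ℝ) →ₗ[ℝ] ℝ} (h : (e.tensor c).IsExtension φ) :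
    e.IsExtension (φ ∘ₗ LinearMap.funLeft ℝ ℝ fun s x => s (Sum.inl x)) := by
  intro σ hσ g
  have hρ : (Sum.inl '' σ : Set (S.tensor T).X) ∈ (S.tensor T).contexts := by
    refine ⟨?_, T.contexts_down _ T.empty_mem_contexts _ ?_⟩
    · rwa [Set.preimage_image_eq _ Sum.inl_injective]
    · rintro x ⟨y, -, hy⟩
      cases hy
  have hsub : σ ⊆ Sum.inl ⁻¹' (Sum.inl '' σ : Set (S.X ⊕ T.X)) := Set.subset_preimage_image _ _
  refine (h _ hρ fun t => g fun x => t ⟨Sum.inl x.1, x.1, x.2, rfl⟩).trans ?_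
  rw [← e.compatible _ _ hρ.1 hσ hsub, PMF.expect_map]
  refine (PMF.expect_bind _ _ _).trans ?_
  simp_rw [PMF.expect_map]
  congr 1
  funext s
  exact PMF.expect_const (c.prob _ hρ.2) (g (S.restrict hsub s))

theorem IsExtension.right {e : EmpiricalModel S} {c : EmpiricalModel T}
    {φ : ((S.tensor T).Global → ℝ) →ₗ[ℝ] ℝ} (h : (e.tensor c).IsExtension φ) :
    c.IsExtension (φ ∘ₗ LinearMap.funLeft ℝ ℝ fun s x => s (Sum.inr x)) := by
  intro σ hσ g
  have hρ : (Sum.inr '' σ : Set (S.tensor T).X) ∈ (S.tensor T).contexts := by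
    refine ⟨S.contexts_down _ S.empty_mem_contexts _ ?_, ?_⟩
    · rintro x ⟨y, -, hy⟩
      cases hy
    · rwa [Set.preimage_image_eq _ Sum.inr_injective]
  have hsub : σ ⊆ Sum.inr ⁻¹' (Sum.inr '' σ : Set (S.X ⊕ T.X)) := Set.subset_preimage_image _ _
  refine (h _ hρ fun t => g fun x => t ⟨Sum.inr x.1, x.1, x.2, rfl⟩).trans ?_
  rw [← c.compatible _ _ hρ.2 hσ hsub, PMF.expect_map]
  refine (PMF.expect_bind _ _ _).trans ?_
  simp_rw [PMF.expect_map]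
  exact PMF.expect_const (e.prob _ hρ.1) ((c.prob _ hρ.2).expect fun t => g (T.restrict hsub t))

end EmpiricalModel

/-! ### Running measurement protocols on global assignments -/

namespace Scenario

variable {S : Scenario.{u}}

/-- A global assignment gives the outcomes recorded in a run. -/
def Agrees (a : S.Global) (l : List (Σ x : S.X, S.O x)) : Prop :=
  ∀ x o, ⟨x, o⟩ ∈ l → a x = o

/-- The measurements that occur in a run. -/
def runSupport (l : List (Σ x : S.X, S.O x)) : Set S.X := {x | ∃ o, ⟨x, o⟩ ∈ l}

theorem Agrees.mono {a : S.Global} {l m : List (Σ x : S.X, S.O x)} (h : Agrees a m)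
    (hlm : l ⊆ m) : Agrees a l :=
  fun x o ho => h x o (hlm ho)

namespace Protocol

/-- A longest run agreeing with `a` is maximal: if the protocol continued with a measurement `x`,
then it would also contain the continuation with outcome `a x`. -/
theorem exists_outcome_agrees (Q : S.Protocol) (a : S.Global) :
    ∃ r : Q.Outcome, Agrees a r.1 := by
  have hf : {l | l ∈ Q.runs ∧ Agrees a l}.Finite :=
    S.finite_isRun.subset fun l hl => Q.isRun l hl.1
  obtain ⟨l, ⟨hl, hla⟩, hmax⟩ := Set.exists_max_image _ List.length hf
    ⟨[], Q.nil_mem, fun x o h => absurd h List.not_mem_nil⟩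
  refine ⟨⟨l, hl, ?_⟩, hla⟩
  rintro m hm ⟨_ | ⟨⟨x, o⟩, k⟩, rfl⟩
  · simp
  · have hx : l ++ [⟨x, o⟩] ∈ Q.runs := Q.prefix_mem _ k (by simpa using hm)
    have := hmax (l ++ [⟨x, a x⟩]) ⟨Q.all_outcomes l x o hx _, fun y p hp => ?_⟩
    · simp at this
    · rcases List.mem_append.mp hp with hp | hp
      · exact hla y p hp
      · simp only [List.mem_singleton, Sigma.mk.injEq] at hp
        obtain ⟨rfl, hp⟩ := hp
        exact (eq_of_heq hp).symm

/-- By `determinate` the next measurement is forced, and `a` forces its outcome, so runs agreeing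
with `a` cannot branch. -/
theorem prefix_of_agrees (Q : S.Protocol) {a : S.Global} {r : Q.Outcome} (hr : Agrees a r.1)
    (l : List (Σ x : S.X, S.O x)) (hl : l ∈ Q.runs) (hla : Agrees a l) : l <+: r.1 := by
  induction l using List.reverseRecOn with
  | nil => exact List.nil_prefix
  | append_singleton l p ih =>
    obtain ⟨x, o⟩ := p
    obtain ⟨_ | ⟨⟨y, o'⟩, k⟩, hk⟩ := ih (Q.prefix_mem _ _ hl) (hla.mono (by simp))
    · have h := r.2.2 _ hl (by rw [← hk]; simp)
      rw [← hk] at h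
      simp at h
    · have hy : l ++ [⟨y, o'⟩] ∈ Q.runs := Q.prefix_mem _ k (by simpa [hk] using r.2.1)
      obtain rfl := Q.determinate l x o y o' hl hy
      have ho : o = o' := (hla x o (by simp)).symm.trans (hr x o' (by rw [← hk]; simp))
      subst ho
      exact ⟨k, by simpa using hk⟩

theorem outcome_unique (Q : S.Protocol) {a : S.Global} {r r' : Q.Outcome}
    (hr : Agrees a r.1) (hr' : Agrees a r'.1) : r = r' :=
  Subtype.ext (r.2.2 _ r'.2.1 (Q.prefix_of_agrees hr' _ r.2.1 hr)).symm

/-- The outcome of a protocol when it is run on a global assignment. -/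
noncomputable def outcome (Q : S.Protocol) (a : S.Global) : Q.Outcome :=
  (Q.exists_outcome_agrees a).choose

theorem agrees_outcome (Q : S.Protocol) (a : S.Global) : Agrees a (Q.outcome a).1 :=
  (Q.exists_outcome_agrees a).choose_spec

theorem outcome_eq_iff (Q : S.Protocol) {a : S.Global} {r : Q.Outcome} :
    Q.outcome a = r ↔ Agrees a r.1 :=
  ⟨fun h => h ▸ Q.agrees_outcome a, fun h => Q.outcome_unique (Q.agrees_outcome a) h⟩

/-- This is the source of locality: an adaptive protocol looks only at the measurements it actually
makes. -/
theorem outcome_congr (Q : S.Protocol) {a b : S.Global}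
    (h : ∀ x ∈ runSupport (Q.outcome a).1, a x = b x) : Q.outcome b = Q.outcome a :=
  Q.outcome_eq_iff.mpr fun x o ho => (h x ⟨o, ho⟩).symm.trans (Q.agrees_outcome a x o ho)

end Protocol

/-- Running all protocols on a global assignment. -/
noncomputable def outcomes (a : S.Global) : S.MP.Global := fun Q => Protocol.outcome Q a

/-- The measurements made by the protocols in a context, when they are run on the same global
assignment, form a context. -/
theorem iUnion_runSupport_mem {τ : Set S.Protocol} (hτ : S.CompatibleProtocols τ) (a : S.Global) :
    ⋃ Q ∈ τ, runSupport (Q.outcome a).1 ∈ S.contexts := by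
  refine S.contexts_down _ (hτ (fun Q => (Q.1.outcome a).1) (fun Q => (Q.1.outcome a).2.1) ?_) _ ?_
  · intro Q R x o o' h h'
    exact (Q.1.agrees_outcome a x o h).symm.trans (R.1.agrees_outcome a x o' h')
  · intro x hx
    simp only [Set.mem_iUnion] at hx
    obtain ⟨Q, hQ, o, ho⟩ := hx
    exact ⟨o, ⟨Q, hQ⟩, ho⟩

/-- The protocol that makes a single measurement. -/
def single (x : S.X) : S.Protocol where
  runs := {l | l = [] ∨ ∃ o, l = [⟨x, o⟩]}
  isRun := by
    rintro l (rfl | ⟨o, rfl⟩)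
    · exact ⟨List.nodup_nil, by simpa using S.empty_mem_contexts⟩
    · refine ⟨by simp, S.contexts_down _ (S.contexts_singleton x) _ ?_⟩
      rintro y ⟨p, hp⟩
      simp only [List.mem_singleton, Sigma.mk.injEq] at hp
      exact hp.1
  nonempty := ⟨[], Or.inl rfl⟩
  prefix_mem := by
    rintro l m (h | ⟨o, h⟩)
    · exact Or.inl (List.append_eq_nil_iff.mp h).1
    · rcases List.append_eq_singleton_iff.mp h with h | h
      · exact Or.inl h.1
      · exact Or.inr ⟨o, h.1⟩
  all_outcomes := by
    rintro l y p (h | ⟨o, h⟩) p'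
    · simp at h
    · rcases List.append_eq_singleton_iff.mp h with ⟨rfl, h'⟩ | ⟨-, h'⟩
      · simp only [List.cons.injEq, Sigma.mk.injEq, and_true] at h'
        obtain ⟨rfl, -⟩ := h'
        exact Or.inr ⟨p', rfl⟩
      · simp at h'
  determinate := by
    rintro l y p y' p' (h | ⟨o, h⟩) (h' | ⟨o', h'⟩)
    · simp at h
    · simp at h
    · simp at h'
    · have h1 := (List.append_inj' (h.trans (List.nil_append _).symm) rfl).2
      have h2 := (List.append_inj' (h'.trans (List.nil_append _).symm) rfl).2
      simp only [List.cons.injEq, Sigma.mk.injEq, and_true] at h1 h2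
      exact h1.1.trans h2.1.symm

theorem mem_single_runs {x y : S.X} {o : S.O y} {l : List (Σ x : S.X, S.O x)}
    (hl : l ∈ (single x).runs) (h : ⟨y, o⟩ ∈ l) : y = x := by
  obtain rfl | ⟨p, rfl⟩ := hl
  · simp at h
  · simp only [List.mem_singleton, Sigma.mk.injEq] at h
    exact h.1

theorem exists_outcome_single {x : S.X} (r : (single x).Outcome) : ∃ o, r.1 = [⟨x, o⟩] := by
  obtain h | h := r.2.1
  · obtain ⟨o⟩ := S.nonemptyO x
    have := r.2.2 [⟨x, o⟩] (Or.inr ⟨o, rfl⟩) (h ▸ List.nil_prefix)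
    rw [h] at this
    simp at this
  · exact h

/-- Reading off the outcome of a single measurement. -/
noncomputable def readSingle {x : S.X} (r : (single x).Outcome) : S.O x :=
  (exists_outcome_single r).choose

theorem readSingle_outcome (x : S.X) (a : S.Global) :
    readSingle ((single x).outcome a) = a x := by
  have h := (exists_outcome_single ((single x).outcome a)).choose_spec
  exact ((single x).agrees_outcome a x _ (h ▸ List.mem_singleton_self _)).symm

/-- Measuring only the second factor of a tensor product. -/
noncomputable def measureRight (S T : Scenario.{u}) : DetMorphism (S.tensor T).MP T where
  onMeas x := single (S := S.tensor T) (Sum.inr x)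
  simplicial := by
    intro σ hσ r hr _
    refine ⟨S.contexts_down _ S.empty_mem_contexts _ ?_, T.contexts_down _ hσ _ ?_⟩
    · rintro y ⟨o, ⟨Q, x, hx, rfl⟩, hy⟩
      have := mem_single_runs (hr ⟨_, x, hx, rfl⟩) hy
      cases this
    · rintro y ⟨o, ⟨Q, x, hx, rfl⟩, hy⟩
      have := mem_single_runs (hr ⟨_, x, hx, rfl⟩) hy
      cases this
      exact hx
  onOut x r := readSingle (S := S.tensor T) r

end Scenario

/-! ### Extensions of protocol models, and simulation of non-contextual models -/

namespace EmpiricalModel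

variable {S T : Scenario.{u}}

/-- The event that running the protocols on `a` yields `t` is a cylinder over the context formed by
all recorded measurements if the runs are consistent, and is empty otherwise. These are the two
cases of `mpWeight`. -/
theorem IsExtension.MP {e : EmpiricalModel S} {φ : (S.Global → ℝ) →ₗ[ℝ] ℝ} (h : e.IsExtension φ) :
    e.MP.IsExtension (φ ∘ₗ LinearMap.funLeft ℝ ℝ Scenario.outcomes) := by
  classical
  intro τ hτ g
  have key (t : S.MP.Assignment τ) :
      φ (fun a => if S.MP.proj τ (Scenario.outcomes a) = t then 1 else 0) =
        (e.mpWeight τ hτ t).toReal := by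
    have hiff (a : S.Global) : S.MP.proj τ (Scenario.outcomes a) = t ↔
        ∀ Q : τ, Scenario.Agrees a (t Q).1 := by
      rw [funext_iff]
      exact forall_congr' fun Q => Q.1.outcome_eq_iff
    unfold mpWeight
    split_ifs with hc
    · rw [← h.cylinder]
      congr 1
      funext a
      congr 1
      rw [hiff, eq_iff_iff, funext_iff]
      constructor
      · rintro ha ⟨x, hx⟩
        obtain ⟨Q, hQ⟩ := hx.choose_spec
        exact ha Q x _ hQ
      · intro ha Q x o ho
        have hx : x ∈ S.support fun Q : τ => (t Q).1 := ⟨o, Q, ho⟩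
        obtain ⟨R, hR⟩ := hx.choose_spec
        exact (ha ⟨x, hx⟩).trans (hc R Q x _ o hR ho)
    · rw [ENNReal.toReal_zero]
      refine Eq.trans (congrArg φ (funext fun a => ?_)) (map_zero φ)
      refine if_neg fun ha => hc fun Q R x o o' ho ho' => ?_
      exact ((hiff a).mp ha Q x o ho).symm.trans ((hiff a).mp ha R x o' ho')
  have := Fintype.ofFinite (S.MP.Assignment τ)
  have hg : (fun a => g (S.MP.proj τ (Scenario.outcomes a))) =
      ∑ t, g t • fun a => if S.MP.proj τ (Scenario.outcomes a) = t then (1 : ℝ) else 0 := by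
    funext a
    simp
  change φ (fun a => g (S.MP.proj τ (Scenario.outcomes a))) = _
  rw [hg, map_sum, PMF.expect_apply]
  refine Finset.sum_congr rfl fun t _ => ?_
  rw [map_smul, key, smul_eq_mul, mul_comm]
  rfl

theorem NonContextual.tensor {e : EmpiricalModel S} {d : EmpiricalModel T} (he : e.NonContextual)
    (hd : d.NonContextual) : (e.tensor d).NonContextual := by
  obtain ⟨p, hp⟩ := nonContextual_iff.mp he
  obtain ⟨q, hq⟩ := nonContextual_iff.mp hd
  refine nonContextual_iff.mpr ⟨q.bind fun t => p.map fun s => Scenario.pairGlobal s t, ?_⟩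
  convert hp.tensor hq using 1
  ext1 f
  rw [PMF.expect_bind]
  simp_rw [PMF.expect_map]
  rfl

/-- Any model simulates any non-contextual one. -/
theorem NonContextual.simulates {d : EmpiricalModel T} (hd : d.NonContextual)
    (e : EmpiricalModel S) : e.Simulates d := by
  obtain ⟨p, hp⟩ := nonContextual_iff.mp hd
  obtain ⟨φ, hφ⟩ := e.exists_isExtension
  -- The auxiliary model is `d` itself. The signed measure of `e` is integrated against functions
  -- constant in its variable, so only its total mass one matters.
  refine ⟨T, d, hd, Scenario.measureRight S T, hp.unique ?_⟩
  convert (hφ.tensor hp).MP.push (Scenario.measureRight S T) using 1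
  ext1 f
  have h (s : S.Global) (t : T.Global) :
      (Scenario.measureRight S T).mapGlobal (Scenario.outcomes (Scenario.pairGlobal s t)) = t :=
    funext fun x => Scenario.readSingle_outcome (S := S.tensor T) (Sum.inr x) _
  change _ = p.expect fun t => φ fun s => f
    ((Scenario.measureRight S T).mapGlobal (Scenario.outcomes (Scenario.pairGlobal s t)))
  simp_rw [h, hφ.const]

/-! ### Local functions -/

/-- The value `f s` and the set `D s` are determined by the restriction of `s` to `D s`. -/
def _root_.Scenario.IsLocal {β : Type*} (D : S.Global → Set S.X) (f : S.Global → β) : Prop :=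
  ∀ s s', (∀ x ∈ D s, s x = s' x) → D s' = D s ∧ f s' = f s

/-- The number of global assignments that agree with `s` on `D s`. -/
noncomputable def _root_.Scenario.cellCard (D : S.Global → Set S.X) (s : S.Global) : ℕ :=
  Nat.card {s' : S.Global // S.proj (D s) s' = S.proj (D s) s}

open Classical in
/-- On a local function, all extensions of a model take the same value. -/
theorem IsExtension.apply_of_isLocal [Fintype S.Global] {e : EmpiricalModel S}
    {φ : (S.Global → ℝ) →ₗ[ℝ] ℝ} (h : e.IsExtension φ) {D : S.Global → Set S.X}
    {f : S.Global → ℝ} (hD : ∀ s, D s ∈ S.contexts) (hf : Scenario.IsLocal D f) :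
    φ f = ∑ s, f s / Scenario.cellCard D s *
      (e.prob (D s) (hD s) (S.proj (D s) s)).toReal := by
  have hsymm (s s' : S.Global) (hs : S.proj (D s) s' = S.proj (D s) s) :
      D s' = D s ∧ f s' = f s :=
    hf s s' fun x hx => (Scenario.proj_eq_iff.mp hs x hx).symm
  have hiff (s s' : S.Global) :
      S.proj (D s) s' = S.proj (D s) s ↔ S.proj (D s') s = S.proj (D s') s' := by
    constructor
    · intro hs
      rw [(hsymm s s' hs).1, hs]
    · intro hs
      rw [(hsymm s' s hs).1, hs]
  have hcard (s : S.Global) : (Scenario.cellCard D s : ℝ) ≠ 0 := by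
    rw [Nat.cast_ne_zero]
    have : Nonempty {s' : S.Global // S.proj (D s) s' = S.proj (D s) s} := ⟨⟨s, rfl⟩⟩
    exact Nat.card_pos.ne'
  have hsum : f = ∑ s, (f s / Scenario.cellCard D s) •
      fun s' => if S.proj (D s) s' = S.proj (D s) s then (1 : ℝ) else 0 := by
    funext s'
    rw [Finset.sum_apply]
    have hterm (s : S.Global) : ((f s / Scenario.cellCard D s) •
        fun s' => if S.proj (D s) s' = S.proj (D s) s then (1 : ℝ) else 0) s' =
        if S.proj (D s') s = S.proj (D s') s' then f s' / Scenario.cellCard D s' else 0 := by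
      simp only [Pi.smul_apply, smul_eq_mul, mul_ite, mul_one, mul_zero]
      rw [if_congr (hiff s s') rfl rfl]
      split_ifs with hs
      · have hD' := (hsymm s' s hs).1
        rw [(hsymm s' s hs).2]
        unfold Scenario.cellCard
        rw [hD', hs]
      · rfl
    rw [Finset.sum_congr rfl fun s _ => hterm s, ← Finset.sum_filter, Finset.sum_const,
      nsmul_eq_mul, ← Fintype.card_subtype, ← Nat.card_eq_fintype_card]
    exact (mul_div_cancel₀ _ (hcard s')).symm
  conv_lhs => rw [hsum]
  rw [map_sum]
  refine Finset.sum_congr rfl fun s _ => ?_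
  rw [map_smul, h.cylinder, smul_eq_mul]

/-- The signed `φ` need not be positive, but on a local function it is a combination of
probabilities from `e` with non-negative coefficients. -/
theorem IsExtension.nonneg_of_isLocal {e : EmpiricalModel S}
    {φ : (S.Global → ℝ) →ₗ[ℝ] ℝ} (h : e.IsExtension φ) {D : S.Global → Set S.X}
    {f : S.Global → ℝ} (hD : ∀ s, D s ∈ S.contexts) (hf : Scenario.IsLocal D f)
    (h0 : ∀ s, 0 ≤ f s) : 0 ≤ φ f := by
  have := Fintype.ofFinite S.Global
  rw [h.apply_of_isLocal hD hf]
  exact Finset.sum_nonneg fun s _ =>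
    mul_nonneg (div_nonneg (h0 s) (Nat.cast_nonneg _)) ENNReal.toReal_nonneg

theorem IsExtension.eq_of_isLocal {e : EmpiricalModel S}
    {φ ψ : (S.Global → ℝ) →ₗ[ℝ] ℝ} (hφ : e.IsExtension φ) (hψ : e.IsExtension ψ)
    {D : S.Global → Set S.X} {f : S.Global → ℝ} (hD : ∀ s, D s ∈ S.contexts)
    (hf : Scenario.IsLocal D f) : φ f = ψ f := by
  have := Fintype.ofFinite S.Global
  rw [hφ.apply_of_isLocal hD hf, hψ.apply_of_isLocal hD hf]

/-! ### Broadcasting -/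

/-- A family of maps on global assignments with sets of measurements that determine each of
their values, such that copies of contexts indexed by `ι` are jointly determined by contexts. -/
structure _root_.Scenario.Broadcast (S : Scenario.{u}) (ι : Type*) where
  toFun : ι → S.Global → S.Global
  dep : ι → S.X → S.Global → Set S.X
  isLocal : ∀ i x, Scenario.IsLocal (dep i x) fun s => toFun i s x
  context : ∀ s (σ : ι → Set S.X), (∀ i, σ i ∈ S.contexts) →
    ⋃ i, ⋃ x ∈ σ i, dep i x s ∈ S.contexts

/-- The model `e` can be broadcast to copies indexed by `ι`, with shared randomness. -/
def Broadcastable (e : EmpiricalModel S) (ι : Type) : Prop :=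
  ∃ (Λ : Type u) (_ : Finite Λ) (p : PMF Λ) (B : Λ → S.Broadcast ι),
    ∀ φ, e.IsExtension φ → ∀ i (σ : Set S.X) (hσ : σ ∈ S.contexts) (g : S.Assignment σ → ℝ),
      p.expect (fun l => φ fun s => g (S.proj σ ((B l).toFun i s))) = (e.prob σ hσ).expect g

theorem _root_.Scenario.Broadcast.isLocal_iUnion {ι : Type*} (B : S.Broadcast ι) (i : ι)
    {β : Type*} (σ : Set S.X) (g : S.Assignment σ → β) :
    Scenario.IsLocal (fun s => ⋃ x ∈ σ, B.dep i x s) fun s => g (S.proj σ (B.toFun i s)) := by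
  intro s s' h
  have h' : ∀ x ∈ σ, B.dep i x s' = B.dep i x s ∧ B.toFun i s' x = B.toFun i s x :=
    fun x hx => B.isLocal i x s s' fun y hy => h y (Set.mem_biUnion hx hy)
  exact ⟨Set.iUnion₂_congr fun x hx => (h' x hx).1,
    congrArg g (Scenario.proj_eq_iff.mpr fun x hx => (h' x hx).2)⟩

/-- Measure `σ` in copy `i` and the empty context in all others. -/
theorem _root_.Scenario.Broadcast.iUnion_mem {ι : Type*} (B : S.Broadcast ι) (i : ι)
    {σ : Set S.X} (hσ : σ ∈ S.contexts) (s : S.Global) :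
    ⋃ x ∈ σ, B.dep i x s ∈ S.contexts := by
  classical
  refine S.contexts_down _ (B.context s (fun j => if j = i then σ else ∅) fun j => ?_) _ ?_
  · split_ifs
    exacts [hσ, S.empty_mem_contexts]
  · refine Set.iUnion₂_subset fun x hx y hy => ?_
    simp only [Set.mem_iUnion]
    exact ⟨i, x, by simpa using hx, hy⟩

/-- Keep one of two copies and broadcast the other one. -/
def _root_.Scenario.Broadcast.option {ι : Type*} (A : S.Broadcast Bool) (B : S.Broadcast ι) :
    S.Broadcast (Option ι) where
  toFun i s := i.elim (A.toFun false s) fun i => B.toFun i (A.toFun true s)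
  dep i x s := i.elim (A.dep false x s)
    fun i => ⋃ y ∈ B.dep i x (A.toFun true s), A.dep true y s
  isLocal := by
    rintro (_ | i) x
    · exact A.isLocal false x
    · intro s s' h
      have h' : ∀ y ∈ B.dep i x (A.toFun true s),
          A.dep true y s' = A.dep true y s ∧ A.toFun true s' y = A.toFun true s y :=
        fun y hy => A.isLocal true y s s' fun z hz => h z (Set.mem_biUnion hy hz)
      have hB := B.isLocal i x (A.toFun true s) (A.toFun true s') fun y hy => ((h' y hy).2).symm
      refine ⟨?_, hB.2⟩
      simp only [Option.elim_some]
      rw [hB.1]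
      exact Set.iUnion₂_congr fun y hy => (h' y hy).1
  context := by
    intro s σ hσ
    have hτ := B.context (A.toFun true s) (fun i => σ (some i)) fun i => hσ _
    -- The context requested from the copy `true` is everything that `B` consults there.
    refine S.contexts_down _ (A.context s (fun b => bif b then ⋃ i, ⋃ x ∈ σ (some i),
      B.dep i x (A.toFun true s) else σ none) fun b => ?_) _ ?_
    · cases b
      exacts [hσ none, hτ]
    · intro z hz
      simp only [Set.mem_iUnion] at hz ⊢
      obtain ⟨_ | i, x, hx, hz⟩ := hz
      · exact ⟨false, x, hx, hz⟩
      · simp only [Option.elim_some, Set.mem_iUnion] at hz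
        obtain ⟨y, hy, hz⟩ := hz
        refine ⟨true, y, ?_, hz⟩
        simp only [cond_true, Set.mem_iUnion]
        exact ⟨i, x, hx, hy⟩

/-- The signed measure `ψ` of the second copy is again an extension of `e`. It may differ from `φ`,
but what `B` reads in one context of a copy is local, and all extensions agree on local functions.
-/
theorem Broadcastable.option {e : EmpiricalModel S} {ι : Type} (h2 : e.Broadcastable Bool)
    (h : e.Broadcastable ι) : e.Broadcastable (Option ι) := by
  obtain ⟨Λ, _, p, A, hA⟩ := h2
  obtain ⟨Λ', _, q, B, hB⟩ := h
  refine ⟨Λ × Λ', inferInstance, p.bind fun l => q.map fun l' => (l, l'),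
    fun l => (A l.1).option (B l.2), fun φ hφ i σ hσ g => ?_⟩
  rw [PMF.expect_bind]
  simp_rw [PMF.expect_map]
  cases i with
  | none =>
    refine Eq.trans (congrArg p.expect (funext fun l => ?_)) (hA φ hφ false σ hσ g)
    exact PMF.expect_const q (φ fun s => g (S.proj σ ((A l).toFun false s)))
  | some i =>
    let ψ : (S.Global → ℝ) →ₗ[ℝ] ℝ :=
      { toFun := fun f => p.expect fun l => φ fun s => f ((A l).toFun true s)
        map_add' := fun f g => by
          rw [← map_add]
          congr 1
          funext l
          exact map_add φ _ _
        map_smul' := fun r f => by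
          rw [RingHom.id_apply, ← map_smul]
          congr 1
          funext l
          exact map_smul φ r _ }
    have hψ : e.IsExtension ψ := fun σ hσ g => hA φ hφ true σ hσ g
    rw [PMF.expect_comm, ← hB φ hφ i σ hσ g]
    congr 1
    funext l
    exact hψ.eq_of_isLocal hφ (fun s => (B l).iUnion_mem i hσ s) ((B l).isLocal_iUnion i σ g)

theorem broadcastable_empty (e : EmpiricalModel S) : e.Broadcastable Empty :=
  ⟨PUnit, inferInstance, PMF.pure ⟨⟩, fun _ =>
    { toFun := fun i => i.elim
      dep := fun i => i.elim
      isLocal := fun i => i.elim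
      context := fun _ _ _ => by simpa using S.empty_mem_contexts },
    fun _ _ i => i.elim⟩

theorem Broadcastable.exists_card {e : EmpiricalModel S} (h : e.Broadcastable Bool) (n : ℕ) :
    ∃ (ι : Type) (_ : Fintype ι), Fintype.card ι = n ∧ e.Broadcastable ι := by
  induction n with
  | zero => exact ⟨Empty, inferInstance, rfl, e.broadcastable_empty⟩
  | succ n ih =>
    obtain ⟨ι, _, rfl, hι⟩ := ih
    exact ⟨Option ι, inferInstance, Fintype.card_option, h.option hι⟩

/-- The map that a deterministic morphism from measurement protocols induces on pairs of global
assignments, with the measurements of the first factor that it uses. -/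
noncomputable def _root_.Scenario.Broadcast.ofMorphism {R : Scenario.{u}}
    (m : DetMorphism (S.tensor R).MP (S.tensor S)) (r : R.Global) : S.Broadcast Bool where
  toFun b s x := bif b
    then m.mapGlobal (Scenario.outcomes (Scenario.pairGlobal s r)) (Sum.inr x)
    else m.mapGlobal (Scenario.outcomes (Scenario.pairGlobal s r)) (Sum.inl x)
  dep b x s := Sum.inl ⁻¹' Scenario.runSupport (S := S.tensor R)
    (Scenario.Protocol.outcome (m.onMeas (bif b then Sum.inr x else Sum.inl x))
      (Scenario.pairGlobal s r)).1
  isLocal := by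
    intro b x s s' h
    have hQ (Q : (S.tensor R).Protocol) (h : ∀ y : S.X,
        y ∈ Sum.inl ⁻¹' Scenario.runSupport (Q.outcome (Scenario.pairGlobal s r)).1 →
          s y = s' y) :
        Q.outcome (Scenario.pairGlobal s' r) = Q.outcome (Scenario.pairGlobal s r) := by
      apply Q.outcome_congr
      rintro (y | y) hy
      · exact h y hy
      · rfl
    have := hQ _ h
    constructor
    · exact congrArg (fun o => Sum.inl ⁻¹' Scenario.runSupport (Subtype.val o)) this
    · cases b
      · exact congrArg (m.onOut (Sum.inl x)) this
      · exact congrArg (m.onOut (Sum.inr x)) this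
  context := by
    intro s σ hσ
    -- The context `σ false ⊔ σ true`; its image under `m` is a compatible set of protocols.
    have hρ : {y | Sum.elim (· ∈ σ false) (· ∈ σ true) y} ∈ (S.tensor S).contexts :=
      ⟨hσ false, hσ true⟩
    have := Scenario.iUnion_runSupport_mem (m.simplicial _ hρ) (Scenario.pairGlobal s r)
    refine S.contexts_down _ this.1 _ ?_
    intro y hy
    simp only [Set.mem_iUnion] at hy
    obtain ⟨b, x, hx, hy⟩ := hy
    cases b
    · exact Set.mem_biUnion ⟨Sum.inl x, hx, rfl⟩ hy
    · exact Set.mem_biUnion ⟨Sum.inr x, hx, rfl⟩ hy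

/-- The shared randomness is a global assignment of the auxiliary model `c`. The product of `φ` with
its distribution is transported to an extension of `e ⊗ e`, whose two marginals extend `e`. -/
theorem Simulates.broadcastable {e : EmpiricalModel S} (h : e.Simulates (e.tensor e)) :
    e.Broadcastable Bool := by
  obtain ⟨R, c, hc, m, hm⟩ := h
  obtain ⟨p, hp⟩ := nonContextual_iff.mp hc
  refine ⟨R.Global, inferInstance, p, Scenario.Broadcast.ofMorphism m, fun φ hφ b σ hσ g => ?_⟩
  have hext := (hφ.tensor hp).MP.push m
  rw [← hm] at hext
  cases b
  · exact hext.left σ hσ g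
  · exact hext.right σ hσ g

/-! ### Non-contextuality of broadcastable models -/

open Classical in
/-- The non-contextual fraction is attained: if there are subprobability distributions of mass
arbitrarily close to one below `e`, then `e` is non-contextual. -/
theorem nonContextual_of_subprobability [Fintype S.Global] {e : EmpiricalModel S}
    (h : ∀ ε > 0, ∃ q : S.Global → ℝ, (∀ s, 0 ≤ q s) ∧
      (∀ (σ : Set S.X) (hσ : σ ∈ S.contexts) (t : S.Assignment σ),
        (∑ s, if S.proj σ s = t then q s else 0) ≤ (e.prob σ hσ t).toReal) ∧
      1 - ε ≤ ∑ s, q s) : e.NonContextual := by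
  let C : Set (S.Global → ℝ) := ⋂ (σ : Set S.X) (hσ : σ ∈ S.contexts) (t : S.Assignment σ),
    {q | (∑ s, if S.proj σ s = t then q s else 0) ≤ (e.prob σ hσ t).toReal}
  have hC : IsClosed C := by
    refine isClosed_iInter fun σ => isClosed_iInter fun hσ => isClosed_iInter fun t =>
      isClosed_le (continuous_finsetSum _ fun s _ => ?_) continuous_const
    split_ifs
    exacts [continuous_apply s, continuous_const]
  have hmem (q : S.Global → ℝ) (h0 : ∀ s, 0 ≤ q s)
      (hq : ∀ (σ : Set S.X) (hσ : σ ∈ S.contexts) (t : S.Assignment σ),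
        (∑ s, if S.proj σ s = t then q s else 0) ≤ (e.prob σ hσ t).toReal) :
      q ∈ Set.Icc (0 : S.Global → ℝ) 1 ∩ C := by
    refine ⟨⟨h0, fun s => ?_⟩, by simpa [C] using hq⟩
    -- The empty context bounds the total mass by one, so the candidates lie in a compact box.
    have hs := hq ∅ S.empty_mem_contexts (S.proj ∅ s)
    have hs' (s' : S.Global) : S.proj ∅ s' = S.proj ∅ s := funext fun x => x.2.elim
    simp_rw [hs', if_true] at hs
    calc q s ≤ ∑ s, q s := Finset.single_le_sum (fun s _ => h0 s) (Finset.mem_univ s)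
      _ ≤ _ := hs
      _ ≤ 1 := ENNReal.toReal_le_of_le_ofReal zero_le_one (by simpa using PMF.coe_le_one _ _)
  obtain ⟨q₁, h₁, h₁', -⟩ := h 1 one_pos
  obtain ⟨q, ⟨⟨hq0, -⟩, hqC⟩, hmax⟩ := (isCompact_Icc.inter_right hC).exists_isMaxOn
    ⟨q₁, hmem q₁ h₁ h₁'⟩ (f := fun q => ∑ s, q s)
    (continuous_finsetSum _ fun s _ => continuous_apply s).continuousOn
  have hqC' : ∀ (σ : Set S.X) (hσ : σ ∈ S.contexts) (t : S.Assignment σ),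
      (∑ s, if S.proj σ s = t then q s else 0) ≤ (e.prob σ hσ t).toReal := by
    simpa [C] using hqC
  have hge : 1 ≤ ∑ s, q s := by
    refine le_of_forall_pos_le_add fun ε hε => ?_
    obtain ⟨q', h0, h', hle⟩ := h ε hε
    have := hmax (hmem q' h0 h')
    simp only [Set.mem_ofPred_eq] at this
    linarith
  have hmarg (σ : Set S.X) [Fintype (S.Assignment σ)] :
      ∑ t, (∑ s, if S.proj σ s = t then q s else 0) = ∑ s, q s := by
    rw [Finset.sum_comm]
    simp
  -- Termwise inequality becomes equality because the left side has total at least one and the right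
  -- side total one.
  have heq (σ : Set S.X) (hσ : σ ∈ S.contexts) (t : S.Assignment σ) :
      (∑ s, if S.proj σ s = t then q s else 0) = (e.prob σ hσ t).toReal := by
    have := Fintype.ofFinite (S.Assignment σ)
    refine (Finset.sum_eq_sum_iff_of_le fun t _ => hqC' σ hσ t).mp (le_antisymm
      (Finset.sum_le_sum fun t _ => hqC' σ hσ t) ?_) t (Finset.mem_univ t)
    rw [hmarg, PMF.sum_toReal]
    exact hge
  have hone : ∑ s, q s = 1 := by
    have := Fintype.ofFinite (S.Assignment ∅)
    rw [← hmarg ∅, Finset.sum_congr rfl fun t _ => heq ∅ S.empty_mem_contexts t, PMF.sum_toReal]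
  let p : PMF S.Global := PMF.ofFintype (fun s => ENNReal.ofReal (q s)) (by
    rw [← ENNReal.ofReal_sum_of_nonneg fun s _ => hq0 s, hone, ENNReal.ofReal_one])
  refine nonContextual_iff.mpr ⟨p, fun σ hσ g => ?_⟩
  have := Fintype.ofFinite (S.Assignment σ)
  have hp (s : S.Global) : (p s).toReal = q s := ENNReal.toReal_ofReal (hq0 s)
  simp_rw [PMF.expect_apply, ← heq σ hσ, hp, Finset.sum_mul]
  rw [Finset.sum_comm]
  simp

/-- Only boundedly many copies of a broadcast do not admit joint measurement. -/
theorem _root_.Scenario.Broadcast.card_not_mem_le {ι : Type} [Fintype ι]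
    (B : S.Broadcast ι) [DecidablePred fun i => ∀ s, ⋃ x, B.dep i x s ∈ S.contexts] :
    (Finset.univ.filter fun i => ¬ ∀ s, ⋃ x, B.dep i x s ∈ S.contexts).card ≤
      Nat.card S.X * Nat.card ((S.Global → S.Global) × (S.X → S.Global → Set S.X)) := by
  classical
  have := Fintype.ofFinite ((S.Global → S.Global) × (S.X → S.Global → Set S.X))
  have := Fintype.ofFinite S.X
  let code (i : ι) : (S.Global → S.Global) × (S.X → S.Global → Set S.X) := (B.toFun i, B.dep i)
  refine (Finset.card_le_mul_card_image (f := code) _ (Nat.card S.X) ?_).trans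
    (Nat.mul_le_mul_left _ ((Finset.card_le_univ _).trans Nat.card_eq_fintype_card.ge))
  intro c hc
  obtain ⟨i, hi, rfl⟩ := Finset.mem_image.mp hc
  by_contra! hlt
  rw [Nat.card_eq_fintype_card, ← Fintype.card_coe] at hlt
  refine (Finset.mem_filter.mp hi).2 fun s => ?_
  -- Assign to each measurement `x` its own copy `f x` with the same code as `i`. Measuring just `x`
  -- in copy `f x` asks at most one measurement of each copy, yet consults all that copy `i` would
  -- need for every `x`.
  obtain ⟨f⟩ := Function.Embedding.nonempty_of_card_le hlt.le
  have hf (x : S.X) : B.dep (f x).1 = B.dep i :=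
    congrArg Prod.snd (Finset.mem_filter.mp (f x).2).2
  refine S.contexts_down _ (B.context s (fun j => {x | (f x).1 = j}) fun j => ?_) _ ?_
  · have hsub : {x | (f x).1 = j}.Subsingleton := fun x hx y hy =>
      f.injective (Subtype.ext (hx.trans hy.symm))
    obtain h | ⟨x, h⟩ := hsub.eq_empty_or_singleton <;> rw [h]
    exacts [S.empty_mem_contexts, S.contexts_singleton x]
  · refine Set.iUnion_subset fun x y hy => ?_
    simp only [Set.mem_iUnion]
    exact ⟨(f x).1, x, rfl, by rwa [hf x]⟩

/-- The subdistribution is the law of a uniformly chosen copy, with the copies that are not jointly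
measurable discarded. -/
theorem Broadcastable.nonContextual {e : EmpiricalModel S} (h : e.Broadcastable Bool) :
    e.NonContextual := by
  classical
  have := Fintype.ofFinite S.Global
  refine nonContextual_of_subprobability fun ε hε => ?_
  obtain ⟨φ, hφ⟩ := e.exists_isExtension
  set K := Nat.card S.X * Nat.card ((S.Global → S.Global) × (S.X → S.Global → Set S.X))
  -- Since `K` does not depend on the number of copies, this makes the discarded fraction `K / n`
  -- smaller than `ε`.
  obtain ⟨n, hn⟩ := exists_nat_gt (K / ε)
  have hn0 : (0 : ℝ) < n := lt_of_le_of_lt (by positivity) hn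
  obtain ⟨ι, _, hι, Λ, _, p, B, hB⟩ := h.exists_card n
  let good (l : Λ) (i : ι) : Prop := ∀ s, ⋃ x, (B l).dep i x s ∈ S.contexts
  have hlocal (l : Λ) (i : ι) (hg : good l i) (f : S.Global → ℝ) (hf : ∀ s, 0 ≤ f s) :
      0 ≤ φ fun s => f ((B l).toFun i s) := by
    have := (B l).isLocal_iUnion i Set.univ fun t => f fun x => t ⟨x, trivial⟩
    simp only [Set.mem_univ, Set.iUnion_true] at this
    exact hφ.nonneg_of_isLocal hg this fun s => hf _
  let w (f : S.Global → ℝ) : ℝ :=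
    p.expect fun l => ∑ i, (n : ℝ)⁻¹ * if good l i then φ fun s => f ((B l).toFun i s) else 0
  have hw_sum (P : S.Global → Prop) : (∑ s₀, if P s₀ then w (fun s => if s = s₀ then 1 else 0)
      else 0) = w fun s => if P s then 1 else 0 := by
    rw [← Finset.sum_filter]
    simp only [w]
    rw [← map_sum]
    congr 1
    funext l
    rw [Finset.sum_apply, Finset.sum_comm]
    refine Finset.sum_congr rfl fun i _ => ?_
    rw [← Finset.mul_sum]
    split_ifs
    · rw [← map_sum]
      congr 2
      funext s
      rw [Finset.sum_apply, Finset.sum_filter, Finset.sum_eq_single ((B l).toFun i s)]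
      · simp
      · intro s' _ hs'
        rw [if_neg hs'.symm, ite_self]
      · simp
    · simp
  refine ⟨fun s₀ => w fun s => if s = s₀ then 1 else 0, fun s₀ => ?_, fun σ hσ t => ?_, ?_⟩
  · refine (map_zero p.expect).ge.trans ?_
    refine p.expect_mono fun l => Finset.sum_nonneg fun i _ => ?_
    refine mul_nonneg (by positivity) ?_
    split_ifs with hg
    · exact hlocal l i hg (fun s => if s = s₀ then 1 else 0) fun s => by positivity
    · rfl
  · rw [hw_sum fun s => S.proj σ s = t]
    calc w (fun s => if S.proj σ s = t then 1 else 0)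
        ≤ p.expect fun l => ∑ i, (n : ℝ)⁻¹ *
            φ fun s => if S.proj σ ((B l).toFun i s) = t then 1 else 0 := by
          refine p.expect_mono fun l => Finset.sum_le_sum fun i _ =>
            mul_le_mul_of_nonneg_left ?_ (by positivity)
          split_ifs
          · rfl
          -- A discarded copy still contributes non-negatively on a single context, so restoring it
          -- only increases the sum.
          · exact hφ.nonneg_of_isLocal ((B l).iUnion_mem i hσ)
              ((B l).isLocal_iUnion i σ fun t' => if t' = t then (1 : ℝ) else 0)
              fun s => by positivity
      _ = ∑ i : ι, (n : ℝ)⁻¹ * (e.prob σ hσ t).toReal := by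
          rw [← Finset.sum_fn, map_sum]
          refine Finset.sum_congr rfl fun i _ => ?_
          rw [← PMF.expect_single, ← hB φ hφ i σ hσ, ← smul_eq_mul, ← map_smul]
          rfl
      _ = (e.prob σ hσ t).toReal := by
          rw [Finset.sum_const, Finset.card_univ, hι, nsmul_eq_mul]
          field_simp
  · have := hw_sum fun _ => True
    simp only [if_true] at this
    -- For each `l` the mass is the proportion of good copies, because `φ` has total mass one.
    rw [this, ← PMF.expect_const p (1 - ε)]
    refine p.expect_mono fun l => ?_
    have hbad := (B l).card_not_mem_le
    have hcard := Finset.card_filter_add_card_filter_not (s := Finset.univ) (good l)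
    have h1 : (φ fun _ => 1) = 1 := hφ.const 1
    rw [← Finset.mul_sum]
    simp only [h1]
    rw [← Finset.sum_filter, Finset.sum_const, nsmul_eq_mul, mul_one]
    rw [Finset.card_univ, hι] at hcard
    have h2 : (n : ℝ) ≤ (Finset.univ.filter (good l)).card + K := by
      rw [← hcard]
      push_cast
      gcongr
    rw [div_lt_iff₀ hε] at hn
    rw [← div_eq_inv_mul, le_div_iff₀ hn0]
    linarith

end EmpiricalModel

theorem mainTheorem3 {S : Scenario.{u}} (e : EmpiricalModel S) :
    e.Simulates (e.tensor e) ↔ e.NonContextual :=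
  ⟨fun h => h.broadcastable.nonContextual, fun h => (h.tensor h).simulates e⟩
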